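/- Work on the circle $\mathbb{T}=\mathbb{R}/2\pi\mathbb{Z}$ with $\widehat u(k)=\frac1{2\pi}\int_0^{2\pi}u(x)e^{-ikx}\,dx$. For $s\in\mathbb{R}$ put $\|u\|_{H^s}=(2\pi)^{1/2}\big(\sum_{k\in\mathbb{Z}}(1+k^2)^s|\widehat u(k)|^2\big)^{1/2}$, and let $H^s_0$ be the space of real-valued periodic distributions $u$ with $\widehat u(0)=0$ and $\|u\|_{H^s}<\infty$. For $N>0$ and constants $C=(C_j)_{j\ge0}$, call $\beta:\mathbb{R}\to\mathbb{R}$ a bump adapted to $[-N,N]$ (with constants $C$) if $\beta$ is smooth and even, vanishes outside $[-N,N]$, equals $1$ on $[-N/2,N/2]$, and satisfies $|\beta^{(j)}|\le C_jN^{-j}$ for all $j\ge 0$. Let $B$ be the Fourier multiplier $\widehat{Bf}(k)=\beta(k)\widehat f(k)$, let $P_0f=\widehat f(0)$, and let $$M_Bv:=v_x+B(v^2)-P_0(v^2).$$ Let $s\ge-\frac12$, $R>0$, and $C=(C_j)_{j\ge 0}$. There are constants $N_0,L$ and a function $N_1:\mathbb{R}\to\mathbb{R}$, depending only on $s$, $R$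 and $C$, such that for every $N\ge N_0$ and every bump $\beta$ adapted to $[-N,N]$ with constants $C$ there is a map $M_B^{-1}$, defined on the ball $\mathbf{B}=\{u\in H^s_0:\|u\|_{H^s}\le R\}$ with values in $H^{s+1}_0$, that inverts $M_B$ and is Lipschitz: 1. $M_B(M_B^{-1}u)=u$ for all $u\in\mathbf{B}$; 2. $M_B^{-1}(M_Bv)=v$ for every $v\in H^{s+1}_0$ with $M_Bv\in\mathbf{B}$, provided that either $\beta\ge0$, or $\|v\|_{H^{s+1}}\le\rho$ for some $\rho$ with $N\ge N_1(\rho)$; 3. $\|M_B^{-1}u_1-M_B^{-1}u_2\|_{H^{s+1}}\le L\,\|u_1-u_2\|_{H^s}$ for all $u_1,u_2\in\mathbf{B}$. -/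

import Mathlib

open scoped ContDiff ComplexConjugate

namespace TorusSobolev

/-- A periodic distribution on the circle `ℝ / 2πℤ`, given by its Fourier coefficients
`û(k) = (1/2π) ∫₀^{2π} u(x) e^{-ikx} dx`. -/
abbrev Coeffs : Type := ℤ → ℂ

/-- The Sobolev norm `‖u‖_{H^s} = (2π)^{1/2} ‖⟨k⟩^s û(k)‖_{ℓ²}`, where `⟨k⟩ = (1 + k²)^{1/2}`. -/
noncomputable def hsNorm (s : ℝ) (u : Coeffs) : ℝ :=
  √(2 * Real.pi) * √(∑' k : ℤ, (1 + (k : ℝ) ^ 2) ^ s * ‖u k‖ ^ 2)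

/-- `H^s_0`: the real-valued periodic distributions of mean zero with finite `H^s` norm. -/
structure MemHs0 (s : ℝ) (u : Coeffs) : Prop where
  summable : Summable fun k : ℤ => (1 + (k : ℝ) ^ 2) ^ s * ‖u k‖ ^ 2
  real_valued : ∀ k, u (-k) = conj (u k)
  mean_zero : u 0 = 0

/-- The closed ball of radius `R` in `H^s_0`, centred at the origin. -/
def ball (s R : ℝ) : Set Coeffs := {u | MemHs0 s u ∧ hsNorm s u ≤ R}

/-- The derivative: `(u_x)^(k) = i k û(k)`. -/
noncomputable def deriv (u : Coeffs) : Coeffs := fun k => Complex.I * k * u k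

/-- The pointwise product: `(u v)^(k) = ∑_{j} û(j) v̂(k - j)`; the series converges absolutely
when `u` and `v` are square integrable (see `fourierCoeff_mul`). -/
noncomputable def mul (u v : Coeffs) : Coeffs := fun k => ∑' j : ℤ, u j * v (k - j)

/-- The Fourier multiplier with symbol `b`. -/
noncomputable def multiplier (b : ℤ → ℝ) (u : Coeffs) : Coeffs := fun k => b k * u k

/-- The mean `P₀ u`, as a constant function. -/
def mean (u : Coeffs) : Coeffs := fun k => if k = 0 then u k else 0

/-- The modified Miura map `M_B v = v_x + B(v²) - P₀(v²)`, where `B` has symbol `b`. -/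
noncomputable def modifiedMiura (b : ℤ → ℝ) (v : Coeffs) : Coeffs :=
  deriv v + multiplier b (mul v v) - mean (mul v v)

/-- `β` is a real even bump function adapted to `[-N, N]`, with derivative bounds
`|β^{(j)}| ≤ C_j N^{-j}`, that equals `1` on `[-N/2, N/2]`. -/
structure IsAdaptedBump (C : ℕ → ℝ) (N : ℝ) (β : ℝ → ℝ) : Prop where
  smooth : ContDiff ℝ ∞ β
  even : ∀ ξ, β (-ξ) = β ξ
  eq_one : ∀ ξ, |ξ| ≤ N / 2 → β ξ = 1
  eq_zero : ∀ ξ, N < |ξ| → β ξ = 0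
  bound : ∀ (j : ℕ) (ξ : ℝ), |iteratedDeriv j β ξ| ≤ C j / N ^ j

/-- On square integrable functions on a circle, `mul` is the pointwise product. -/
theorem fourierCoeff_mul {T : ℝ} [hT : Fact (0 < T)]
    (f g : MeasureTheory.Lp ℂ 2 (AddCircle.haarAddCircle (T := T))) (k : ℤ) :
    fourierCoeff (fun x => f x * g x) k = mul (fourierCoeff f) (fourierCoeff g) k := by
  have hmem : MeasureTheory.MemLp (fun x => fourier k x * conj (g x)) 2
      (AddCircle.haarAddCircle (T := T)) := by
    refine (MeasureTheory.Lp.memLp g).of_le ?_ (Filter.Eventually.of_forall fun x => ?_)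
    · exact (map_continuous (fourier k)).aestronglyMeasurable.mul
        (Complex.continuous_conj.comp_aestronglyMeasurable
          (MeasureTheory.Lp.aestronglyMeasurable g))
    · simp [fourier_apply, Circle.norm_coe]
  have key := (fourierBasis (T := T)).tsum_inner_mul_inner (hmem.toLp _) f
  have h1 : inner ℂ (hmem.toLp _) f = fourierCoeff (fun x => f x * g x) k := by
    rw [MeasureTheory.L2.inner_def, fourierCoeff]
    refine MeasureTheory.integral_congr_ae ?_
    filter_upwards [hmem.coeFn_toLp] with x hx
    simp only [RCLike.inner_apply, hx, map_mul, Complex.conj_conj, smul_eq_mul, fourier_neg]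
    ring
  have h2 (j : ℤ) : inner ℂ (hmem.toLp _) (fourierBasis j) = fourierCoeff g (k - j) := by
    rw [MeasureTheory.L2.inner_def, fourierCoeff, coe_fourierBasis]
    refine MeasureTheory.integral_congr_ae ?_
    filter_upwards [hmem.coeFn_toLp, coeFn_fourierLp 2 j] with x hx hj
    simp only [RCLike.inner_apply, hx, hj, map_mul, Complex.conj_conj, smul_eq_mul]
    rw [← fourier_neg, ← mul_assoc, ← fourier_add]
    congr 3
    ring
  rw [← h1, ← key]
  refine tsum_congr fun j => ?_
  rw [h2, ← (fourierBasis (T := T)).repr_apply_apply, fourierBasis_repr, mul_comm]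

end TorusSobolev

/-!
On mean-zero functions `∂` is invertible, so `M_B v = u` is the quadratic equation
`v + ∂⁻¹ B(v²) = ∂⁻¹ u` in `H^{s+1}_0`, where `s + 1 ≥ 1/2`. It is solved by the method of
continuity: the image of a large ball is relatively open because the linearizations
`d ↦ d + 2 ∂⁻¹ B(v d)` are invertible, relatively closed because they are bounded below, and an
a priori bound keeps the solutions off the boundary of the ball.

The lower bound on the linearization starts from `B = 1` in `L²`. There `v + 2 ∂⁻¹(a v) = z` is a
linear first-order equation with periodic coefficients, and an integrating factor gives a constant
that depends only on `‖a‖` in `L²`. Since `∂⁻¹` gains derivatives, the bound passes to `H^s`, and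
replacing `1` by the symbol of `B`, which agrees with it at low frequencies, is a small
perturbation.

For the a priori bound let `B ≥ 0`. The function `w = v - ∂⁻¹ u` satisfies, up to constants,
`w_x = -B(w² + q)`, where `q` is the cross term. Pairing with `w²`, and using `∫ w² w_x = 0`, bounds
`w_x` in terms of `‖w‖` and forces `w²` to be close to its mean. But `w` has mean zero, hence a
zero, and the oscillation of `w³ / 3 - c w` then bounds `‖w‖`. Symbols of arbitrary sign are
compared on a fixed ball with the symbol `1`.
-/

namespace TorusSobolev

/-! ### The method of continuity for quadratic equations -/

section ContinuityMethod

open Filter Topology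

theorem isClosed_range_of_antilipschitzWith {α β : Type*} [PseudoMetricSpace α] [CompleteSpace α]
    [MetricSpace β] {f : α → β} {K : NNReal} (hK : AntilipschitzWith K f) (hf : Continuous f) :
    IsClosed (Set.range f) := by
  refine isClosed_of_closure_subset fun y hy => ?_
  have hne : NeBot (comap f (𝓝 y)) := by
    rw [comap_neBot_iff]
    intro t ht
    obtain ⟨_, hxt, x, rfl⟩ := mem_closure_iff_nhds.1 hy t ht
    exact ⟨x, hxt⟩
  obtain ⟨x, hx⟩ := CompleteSpace.complete ((cauchy_nhds (a := y)).comap hK.comap_uniformity_le)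
  exact ⟨x, tendsto_nhds_unique (hf.continuousAt.mono_left hx) tendsto_comap⟩

section BoundedBelow

variable {𝕜 X : Type*} [NontriviallyNormedField 𝕜] [NormedAddCommGroup X] [NormedSpace 𝕜 X]

theorem norm_le_two_mul_of_norm_sub_le {S T : X →L[𝕜] X} {K : ℝ} (hK : 0 < K)
    (hT : ∀ v, ‖v‖ ≤ K * ‖T v‖) (hST : ‖T - S‖ ≤ 1 / (4 * K)) (v : X) :
    ‖v‖ ≤ 2 * K * ‖S v‖ := by
  have hTv : ‖T v‖ ≤ ‖S v‖ + 1 / (4 * K) * ‖v‖ :=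
    calc ‖T v‖ = ‖S v + (T - S) v‖ := by simp
      _ ≤ ‖S v‖ + ‖(T - S) v‖ := norm_add_le _ _
      _ ≤ ‖S v‖ + 1 / (4 * K) * ‖v‖ := by
        gcongr
        exact (T - S).le_of_opNorm_le hST v
  have h := (hT v).trans (mul_le_mul_of_nonneg_left hTv hK.le)
  have hcancel : K * (1 / (4 * K) * ‖v‖) = ‖v‖ / 4 := by field_simp
  rw [mul_add, hcancel] at h
  linarith [norm_nonneg v]

theorem isUnit_of_mem_closure_of_bddBelow [CompleteSpace X] {T : X →L[𝕜] X} {K : ℝ}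
    (hT : T ∈ closure {S : X →L[𝕜] X | IsUnit S}) (hK : ∀ v, ‖v‖ ≤ K * ‖T v‖) : IsUnit T := by
  rcases subsingleton_or_nontrivial X with hX | hX
  · exact ⟨1, Subsingleton.elim _ _⟩
  have hK0 : 0 < K := by
    obtain ⟨v, hv⟩ := exists_ne (0 : X)
    by_contra! hneg
    exact hv (norm_le_zero_iff.1
      ((hK v).trans (mul_nonpos_of_nonpos_of_nonneg hneg (norm_nonneg _))))
  obtain ⟨_, ⟨S, rfl⟩, hST⟩ := Metric.mem_closure_iff.1 hT (1 / (4 * K)) (by positivity)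
  rw [dist_eq_norm] at hST
  have hinv : ‖((S⁻¹ : (X →L[𝕜] X)ˣ) : X →L[𝕜] X)‖ ≤ 2 * K := by
    refine ContinuousLinearMap.opNorm_le_bound _ (by positivity) fun v => ?_
    have h := norm_le_two_mul_of_norm_sub_le hK0 hK hST.le (((S⁻¹ : (X →L[𝕜] X)ˣ) : X →L[𝕜] X) v)
    rwa [← mul_apply_eq_comp, Units.mul_inv, one_apply_eq_self] at h
  refine ⟨Units.ofNearby S T (hST.trans_le ?_), rfl⟩
  calc 1 / (4 * K) ≤ (2 * K)⁻¹ := by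
        rw [one_div]
        gcongr
        norm_num
    _ ≤ ‖((S⁻¹ : (X →L[𝕜] X)ˣ) : X →L[𝕜] X)‖⁻¹ := by
        gcongr
        exact norm_pos_iff.2 (Units.ne_zero _)

end BoundedBelow

variable {X : Type*} [NormedAddCommGroup X] [NormedSpace ℝ X]

/-- The linearizations `d ↦ d + 2 Q(a, d)` of `v ↦ v + Q(v, v)` at the points of the ball of radius
`ρ` are bounded below by `1 / K`. -/
def LinearizationBddBelow (Q : X →L[ℝ] X →L[ℝ] X) (ρ K : ℝ) : Prop :=
  ∀ a, ‖a‖ ≤ ρ → ∀ d, ‖d‖ ≤ K * ‖d + (2 : ℝ) • Q a d‖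

theorem isUnit_one_add_of_bddBelow [CompleteSpace X] (A : X →L[ℝ] X) {K : ℝ}
    (hK : ∀ t ∈ Set.Icc (0 : ℝ) 1, ∀ v, ‖v‖ ≤ K * ‖v + t • A v‖) : IsUnit (1 + A) := by
  have hcont : Continuous fun t : ℝ => 1 + t • A := by fun_prop
  have hsub : Set.Icc (0 : ℝ) 1 ⊆ (fun t : ℝ => 1 + t • A) ⁻¹' {S | IsUnit S} := by
    refine isPreconnected_Icc.subset_of_closure_inter_subset (Units.isOpen.preimage hcont)
      ⟨0, ⟨le_rfl, zero_le_one⟩, by simp⟩ ?_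
    rintro t ⟨ht, ht'⟩
    exact isUnit_of_mem_closure_of_bddBelow (hcont.closure_preimage_subset _ ht) (K := K)
      fun v => by simpa using hK t ht' v
  simpa using hsub (Set.right_mem_Icc.2 zero_le_one)

variable {Q : X →L[ℝ] X →L[ℝ] X} {ρ K : ℝ}

theorem LinearizationBddBelow.isUnit [CompleteSpace X] (hK : LinearizationBddBelow Q ρ K) {a : X}
    (ha : ‖a‖ ≤ ρ) : IsUnit (1 + (2 : ℝ) • Q a) := by
  refine isUnit_one_add_of_bddBelow _ (K := K) fun t ht d => ?_
  have hta : ‖t • a‖ ≤ ρ := by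
    rw [norm_smul, Real.norm_of_nonneg ht.1]
    exact (mul_le_of_le_one_left (norm_nonneg a) ht.2).trans ha
  simpa [smul_smul, mul_comm] using hK (t • a) hta d

theorem quadratic_sub (hQ : ∀ x y, Q x y = Q y x) (v w : X) :
    (v + Q v v) - (w + Q w w) = (v - w) + (2 : ℝ) • Q ((2⁻¹ : ℝ) • (v + w)) (v - w) := by
  simp only [map_smul, smul_apply, map_add, map_sub, add_apply, hQ w v]
  module

theorem LinearizationBddBelow.norm_sub_le (hQ : ∀ x y, Q x y = Q y x)
    (hK : LinearizationBddBelow Q ρ K) {v w : X} (hv : ‖v‖ ≤ ρ) (hw : ‖w‖ ≤ ρ) :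
    ‖v - w‖ ≤ K * ‖(v + Q v v) - (w + Q w w)‖ := by
  rw [quadratic_sub hQ]
  refine hK _ ?_ _
  rw [norm_smul, norm_inv, Real.norm_ofNat]
  linarith [norm_add_le v w]

theorem LinearizationBddBelow.injOn (hQ : ∀ x y, Q x y = Q y x)
    (hK : LinearizationBddBelow Q ρ K) :
    Set.InjOn (fun v => v + Q v v) (Metric.closedBall 0 ρ) := by
  intro v hv w hw h
  have hvw := hK.norm_sub_le hQ (mem_closedBall_zero_iff.1 hv) (mem_closedBall_zero_iff.1 hw)
  rw [sub_eq_zero.2 h, norm_zero, mul_zero] at hvw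
  exact sub_eq_zero.1 (norm_le_zero_iff.1 hvw)

theorem LinearizationBddBelow.of_norm_sub_le {Q' : X →L[ℝ] X →L[ℝ] X} (hK0 : 0 < K)
    (hK : LinearizationBddBelow Q ρ K) (hQ : ∀ a, ‖a‖ ≤ ρ → ‖Q a - Q' a‖ ≤ 1 / (8 * K)) :
    LinearizationBddBelow Q' ρ (2 * K) := by
  intro a ha
  refine norm_le_two_mul_of_norm_sub_le (T := 1 + (2 : ℝ) • Q a) (S := 1 + (2 : ℝ) • Q' a) hK0
    (hK a ha) ?_
  calc ‖(1 + (2 : ℝ) • Q a) - (1 + (2 : ℝ) • Q' a)‖ = 2 * ‖Q a - Q' a‖ := by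
        rw [add_sub_add_left_eq_sub, ← smul_sub, norm_smul, Real.norm_ofNat]
    _ ≤ 2 * (1 / (8 * K)) := by
        gcongr
        exact hQ a ha
    _ = 1 / (4 * K) := by
        field_simp
        norm_num

theorem hasStrictFDerivAt_quadratic (hQ : ∀ x y, Q x y = Q y x) (v : X) :
    HasStrictFDerivAt (fun v => v + Q v v) (1 + (2 : ℝ) • Q v) v := by
  have hdiag : HasStrictFDerivAt (fun x : X => (x, x)) _ v :=
    (hasStrictFDerivAt_id (𝕜 := ℝ) v).prodMk (hasStrictFDerivAt_id v)
  have hQv := HasStrictFDerivAt.comp (g := fun p : X × X => Q p.1 p.2) (f := fun x => (x, x)) v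
    (Q.isBoundedBilinearMap.hasStrictFDerivAt (v, v)) hdiag
  refine ((hasStrictFDerivAt_id (𝕜 := ℝ) v).add hQv).congr_fderiv ?_
  ext d
  simp [hQ d v, two_smul]

variable [CompleteSpace X]

theorem LinearizationBddBelow.isOpen_image_ball (hQ : ∀ x y, Q x y = Q y x)
    (hK : LinearizationBddBelow Q ρ K) :
    IsOpen ((fun v => v + Q v v) '' Metric.ball 0 ρ) := by
  rw [isOpen_iff_mem_nhds]
  rintro _ ⟨v, hv, rfl⟩
  have hsurj : (1 + (2 : ℝ) • Q v).range = ⊤ := by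
    rw [LinearMap.range_eq_top]
    exact (ContinuousLinearMap.isUnit_iff_bijective.1
      (hK.isUnit (mem_ball_zero_iff.1 hv).le)).surjective
  rw [← (hasStrictFDerivAt_quadratic hQ v).map_nhds_eq_of_surj hsurj]
  exact image_mem_map (Metric.isOpen_ball.mem_nhds hv)

theorem LinearizationBddBelow.isClosed_image_closedBall (hQ : ∀ x y, Q x y = Q y x)
    (hK : LinearizationBddBelow Q ρ K) :
    IsClosed ((fun v => v + Q v v) '' Metric.closedBall 0 ρ) := by
  have : CompleteSpace (Metric.closedBall (0 : X) ρ) :=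
    Metric.isClosed_closedBall.isComplete.completeSpace_coe
  have hanti : AntilipschitzWith K.toNNReal
      fun v : Metric.closedBall (0 : X) ρ => (v : X) + Q v v := by
    refine AntilipschitzWith.of_le_mul_dist fun v w => ?_
    rw [Subtype.dist_eq, dist_eq_norm, dist_eq_norm]
    refine (hK.norm_sub_le hQ (mem_closedBall_zero_iff.1 v.2)
      (mem_closedBall_zero_iff.1 w.2)).trans ?_
    gcongr
    exact Real.le_coe_toNNReal K
  rw [← Set.range_domRestrict]
  exact isClosed_range_of_antilipschitzWith hanti (by fun_prop)

/-- The image of the open ball is relatively open and closed in the ball of radius `R`: by `hR`, no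
solution reaches the sphere of radius `ρ`. -/
theorem LinearizationBddBelow.exists_eq (hQ : ∀ x y, Q x y = Q y x)
    (hK : LinearizationBddBelow Q ρ K) (hρ : 0 < ρ) {R : ℝ}
    (hR : ∀ v, ‖v‖ ≤ ρ → ‖v + Q v v‖ ≤ R → ‖v‖ < ρ) {y : X} (hy : ‖y‖ ≤ R) :
    ∃ v, ‖v‖ < ρ ∧ v + Q v v = y := by
  have hzero : (0 : X) ∈ Metric.closedBall 0 R := by simpa using (norm_nonneg y).trans hy
  have hsub : Metric.closedBall (0 : X) R ⊆ (fun v => v + Q v v) '' Metric.ball 0 ρ := by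
    refine (convex_closedBall (0 : X) R).isPreconnected.subset_of_closure_inter_subset
      (hK.isOpen_image_ball hQ) ⟨0, hzero, 0, by simpa using hρ, by simp⟩ ?_
    rintro z ⟨hz, hzR⟩
    obtain ⟨v, hv, rfl⟩ := closure_minimal (Set.image_mono Metric.ball_subset_closedBall)
      (hK.isClosed_image_closedBall hQ) hz
    exact ⟨v, mem_ball_zero_iff.2
      (hR v (mem_closedBall_zero_iff.1 hv) (mem_closedBall_zero_iff.1 hzR)), rfl⟩
  obtain ⟨v, hv, hvy⟩ := hsub (mem_closedBall_zero_iff.2 hy)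
  exact ⟨v, mem_ball_zero_iff.1 hv, hvy⟩

end ContinuityMethod

/-! ### Inequalities for functions on an interval -/

section Interval

open Real intervalIntegral

variable {a b : ℝ}

theorem sq_integral_abs_mul_le {f g : ℝ → ℝ} (hf : Continuous f) (hg : Continuous g)
    (hab : a ≤ b) :
    (∫ x in a..b, |f x * g x|) ^ 2 ≤ (∫ x in a..b, f x ^ 2) * ∫ x in a..b, g x ^ 2 := by
  have hquad (t : ℝ) : 0 ≤ (∫ x in a..b, f x ^ 2) * (t * t) +
      (-2 * ∫ x in a..b, |f x * g x|) * t + ∫ x in a..b, g x ^ 2 := by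
    have hsq : 0 ≤ ∫ x in a..b, (t * |f x| - |g x|) ^ 2 :=
      integral_nonneg hab fun x _ => sq_nonneg _
    have hexp : (fun x => (t * |f x| - |g x|) ^ 2) =
        fun x => (t * t * f x ^ 2 + (-2 * t) * |f x * g x|) + g x ^ 2 := by
      ext x
      rw [abs_mul, ← sq_abs (f x), ← sq_abs (g x)]
      ring
    rw [hexp, integral_add, integral_add, integral_const_mul, integral_const_mul] at hsq
    · linarith
    all_goals exact Continuous.intervalIntegrable (by fun_prop) _ _
  have h := discrim_le_zero hquad
  rw [discrim] at h
  linarith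

theorem exists_mem_Icc_eq_of_integral_eq {f : ℝ → ℝ} (hf : Continuous f) (hab : a < b) {c : ℝ}
    (hc : ∫ x in a..b, f x = (b - a) * c) : ∃ x ∈ Set.Icc a b, f x = c := by
  obtain ⟨x, hx, hfx⟩ := exists_eq_interval_average hab.ne hf.continuousOn
  rw [Set.uIoo_of_lt hab] at hx
  rw [interval_average_eq_div, hc, mul_div_cancel_left₀ _ (sub_pos.2 hab).ne'] at hfx
  exact ⟨x, Set.Ioo_subset_Icc_self hx, hfx⟩

theorem abs_sub_le_integral_abs {f f' : ℝ → ℝ} (hf : ∀ x, HasDerivAt f (f' x) x)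
    (hf' : Continuous f') {x y : ℝ} (hx : x ∈ Set.Icc a b) (hy : y ∈ Set.Icc a b) :
    |f x - f y| ≤ ∫ t in a..b, |f' t| := by
  wlog hyx : y ≤ x generalizing x y
  · rw [abs_sub_comm]
    exact this hy hx (le_of_not_ge hyx)
  rw [← integral_eq_sub_of_hasDerivAt (fun t _ => hf t) (hf'.intervalIntegrable _ _)]
  refine (abs_integral_le_integral_abs hyx).trans ?_
  exact integral_mono_interval hy.1 hyx hx.2
    (Filter.Eventually.of_forall fun t => abs_nonneg (f' t)) (hf'.abs.intervalIntegrable _ _)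

/-- With `F = f³ / 3 - c f`, one has `F = 0` at a zero of `f` and `F² = 4/9 c³` where `f² = c`,
while the total variation of `F` is `∫ |(f² - c) f'|`. -/
theorem mean_sq_pow_three_le {f f' : ℝ → ℝ} (hf : ∀ x, HasDerivAt f (f' x) x)
    (hf' : Continuous f') (hab : a < b) {c : ℝ} (hmean : ∫ x in a..b, f x = 0)
    (hc : ∫ x in a..b, f x ^ 2 = (b - a) * c) :
    4 / 9 * c ^ 3 ≤ (∫ x in a..b, (f x ^ 2 - c) ^ 2) * ∫ x in a..b, f' x ^ 2 := by
  have hfc : Continuous f := continuous_iff_continuousAt.2 fun x => (hf x).continuousAt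
  obtain ⟨x₀, hx₀, hf₀⟩ := exists_mem_Icc_eq_of_integral_eq hfc hab (c := 0) (by simpa using hmean)
  obtain ⟨x₁, hx₁, rfl⟩ := exists_mem_Icc_eq_of_integral_eq (hfc.pow 2) hab hc
  set c : ℝ := f x₁ ^ 2 with hc_def
  have hF (x : ℝ) : HasDerivAt (fun x => f x ^ 3 / 3 - c * f x) ((f x ^ 2 - c) * f' x) x := by
    refine ((((hf x).pow 3).div_const 3).sub ((hf x).const_mul c)).congr_deriv ?_
    push_cast
    ring
  calc 4 / 9 * c ^ 3 = |f x₁ ^ 3 / 3 - c * f x₁ - (f x₀ ^ 3 / 3 - c * f x₀)| ^ 2 := by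
        rw [sq_abs, hf₀, hc_def]
        ring
    _ ≤ (∫ x in a..b, |(f x ^ 2 - c) * f' x|) ^ 2 :=
        pow_le_pow_left₀ (abs_nonneg _) (abs_sub_le_integral_abs hF (by fun_prop) hx₁ hx₀) 2
    _ ≤ _ := sq_integral_abs_mul_le (by fun_prop) hf' hab.le

end Interval

section PeriodicODE

open Real intervalIntegral

variable {a b c m : ℝ} {p P w z : ℝ → ℝ}

theorem hasDerivAt_exp_mul_of_ode (hP : ∀ x, HasDerivAt P (p x) x)
    (hw : ∀ x, HasDerivAt w (c - p x * (w x + z x)) x) (x : ℝ) :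
    HasDerivAt (fun x => exp (P x) * w x) (exp (P x) * (c - p x * z x)) x := by
  refine ((hP x).exp.mul (hw x)).congr_deriv ?_
  ring

theorem abs_const_le_of_periodic_ode (hab : a ≤ b) (hp : Continuous p) (hz : Continuous z)
    (hP : ∀ x, HasDerivAt P (p x) x) (hper : P b = P a) (hPm : ∀ x ∈ Set.Icc a b, |P x| ≤ m)
    (hw : ∀ x, HasDerivAt w (c - p x * (w x + z x)) x) (hwper : w b = w a) :
    (b - a) * |c| ≤ exp (2 * m) * ∫ x in a..b, |p x * z x| := by
  have hPc : Continuous P := continuous_iff_continuousAt.2 fun x => (hP x).continuousAt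
  have hmean : c * ∫ x in a..b, exp (P x) = ∫ x in a..b, exp (P x) * (p x * z x) := by
    have h := integral_eq_sub_of_hasDerivAt (a := a) (b := b)
      (fun t _ => hasDerivAt_exp_mul_of_ode hP hw t)
      (Continuous.intervalIntegrable (by fun_prop) _ _)
    simp only [hper, hwper, sub_self, mul_sub] at h
    rw [integral_sub, integral_mul_const] at h
    · linarith
    all_goals exact Continuous.intervalIntegrable (by fun_prop) _ _
  have hlower : (b - a) * exp (-m) ≤ ∫ x in a..b, exp (P x) := by
    have h : ∫ _ in a..b, exp (-m) ≤ ∫ x in a..b, exp (P x) :=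
      integral_mono_on hab (continuous_const.intervalIntegrable _ _)
        (Continuous.intervalIntegrable (by fun_prop) _ _)
        fun x hx => exp_le_exp.2 (neg_le_of_abs_le (hPm x hx))
    simpa using h
  have hupper : |∫ x in a..b, exp (P x) * (p x * z x)| ≤ exp m * ∫ x in a..b, |p x * z x| := by
    refine (abs_integral_le_integral_abs hab).trans ?_
    rw [← integral_const_mul]
    refine integral_mono_on hab (Continuous.intervalIntegrable (by fun_prop) _ _)
      (Continuous.intervalIntegrable (by fun_prop) _ _) fun x hx => ?_
    rw [abs_mul, abs_exp]
    gcongr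
    exact (le_abs_self _).trans (hPm x hx)
  calc (b - a) * |c| = exp m * (|c| * ((b - a) * exp (-m))) := by
        rw [exp_neg]
        field_simp
    _ ≤ exp m * (|c| * |∫ x in a..b, exp (P x)|) := by
        gcongr
        exact hlower.trans (le_abs_self _)
    _ ≤ exp m * (exp m * ∫ x in a..b, |p x * z x|) := by
        rw [← abs_mul, hmean]
        gcongr
    _ = _ := by rw [← mul_assoc, ← exp_add, two_mul]

theorem abs_le_of_periodic_ode (hab : a < b) (hp : Continuous p) (hz : Continuous z)
    (hP : ∀ x, HasDerivAt P (p x) x) (hper : P b = P a) (hPm : ∀ x ∈ Set.Icc a b, |P x| ≤ m)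
    (hw : ∀ x, HasDerivAt w (c - p x * (w x + z x)) x) (hwper : w b = w a)
    (hmean : ∫ x in a..b, w x = 0) {x : ℝ} (hx : x ∈ Set.Icc a b) :
    |w x| ≤ exp (2 * m) * (exp (2 * m) + 1) * ∫ x in a..b, |p x * z x| := by
  have hPc : Continuous P := continuous_iff_continuousAt.2 fun x => (hP x).continuousAt
  have hwc : Continuous w := continuous_iff_continuousAt.2 fun x => (hw x).continuousAt
  obtain ⟨x₀, hx₀, hw₀⟩ := exists_mem_Icc_eq_of_integral_eq hwc hab (c := 0) (by simpa using hmean)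
  have hvar : ∫ t in a..b, |exp (P t) * (c - p t * z t)| ≤
      exp m * ((exp (2 * m) + 1) * ∫ x in a..b, |p x * z x|) :=
    calc ∫ t in a..b, |exp (P t) * (c - p t * z t)| ≤
        ∫ t in a..b, exp m * (|c| + |p t * z t|) := by
          refine integral_mono_on hab.le (Continuous.intervalIntegrable (by fun_prop) _ _)
            (Continuous.intervalIntegrable (by fun_prop) _ _) fun x hx => ?_
          rw [abs_mul, abs_exp]
          gcongr
          · exact (le_abs_self _).trans (hPm x hx)
          · exact abs_sub _ _
      _ = exp m * ((b - a) * |c| + ∫ x in a..b, |p x * z x|) := by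
          rw [integral_const_mul, integral_add (continuous_const.intervalIntegrable _ _)
            (Continuous.intervalIntegrable (by fun_prop) _ _), integral_const, smul_eq_mul]
      _ ≤ _ := by
          rw [add_mul, one_mul]
          gcongr exp m * (?_ + _)
          exact abs_const_le_of_periodic_ode hab.le hp hz hP hper hPm hw hwper
  have hosc := abs_sub_le_integral_abs (hasDerivAt_exp_mul_of_ode hP hw) (by fun_prop) hx hx₀
  rw [hw₀, mul_zero, sub_zero, abs_mul, abs_exp] at hosc
  calc |w x| = exp m * (exp (-m) * |w x|) := by rw [← mul_assoc, ← exp_add]; simp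
    _ ≤ exp m * (exp (P x) * |w x|) := by
        gcongr
        exact neg_le_of_abs_le (hPm x hx)
    _ ≤ exp m * (exp m * ((exp (2 * m) + 1) * ∫ x in a..b, |p x * z x|)) := by
        gcongr exp m * ?_
        exact hosc.trans hvar
    _ = _ := by rw [two_mul m, exp_add]; ring

theorem abs_primitive_le_sqrt (hp : Continuous p) {ρ : ℝ} (hρ : ∫ x in a..b, p x ^ 2 ≤ ρ) {x : ℝ}
    (hx : x ∈ Set.Icc a b) : |∫ t in a..x, p t| ≤ √(ρ * (b - a)) := by
  have hab : a ≤ b := hx.1.trans hx.2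
  have hcs := sq_integral_abs_mul_le hp (continuous_const (y := (1 : ℝ))) hab
  simp only [mul_one, one_pow, integral_const, smul_eq_mul] at hcs
  have : 0 ≤ b - a := sub_nonneg.2 hab
  calc |∫ t in a..x, p t| ≤ ∫ t in a..x, |p t| := abs_integral_le_integral_abs hx.1
    _ ≤ ∫ t in a..b, |p t| := integral_mono_interval le_rfl hx.1 hx.2
        (Filter.Eventually.of_forall fun t => abs_nonneg (p t)) (hp.abs.intervalIntegrable _ _)
    _ ≤ √(ρ * (b - a)) := Real.le_sqrt_of_sq_le (hcs.trans (by gcongr))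

theorem exists_integral_sq_le_of_periodic_ode (hab : a < b) (ρ : ℝ) :
    ∃ K : ℝ, 0 ≤ K ∧ ∀ p w z : ℝ → ℝ, ∀ c : ℝ, Continuous p → Continuous z →
      (∀ x, HasDerivAt w (c - p x * (w x + z x)) x) → w b = w a →
      ∫ x in a..b, p x = 0 → ∫ x in a..b, w x = 0 → ∫ x in a..b, p x ^ 2 ≤ ρ →
      ∫ x in a..b, w x ^ 2 ≤ K * ∫ x in a..b, z x ^ 2 := by
  set m : ℝ := √(ρ * (b - a))
  set D : ℝ := exp (2 * m) * (exp (2 * m) + 1)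
  have : 0 ≤ b - a := (sub_pos.2 hab).le
  refine ⟨(b - a) * D ^ 2 * |ρ|, by positivity, fun p w z c hp hz hw hwper hpmean hwmean hpρ => ?_⟩
  have hwc : Continuous w := continuous_iff_continuousAt.2 fun x => (hw x).continuousAt
  have hP (x : ℝ) : HasDerivAt (fun x => ∫ t in a..x, p t) (p x) x :=
    integral_hasDerivAt_right (hp.intervalIntegrable _ _)
      hp.aestronglyMeasurable.stronglyMeasurableAtFilter hp.continuousAt
  have hpointwise {x : ℝ} (hx : x ∈ Set.Icc a b) : |w x| ≤ D * ∫ x in a..b, |p x * z x| :=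
    abs_le_of_periodic_ode hab hp hz hP (by simpa using hpmean)
      (fun y hy => abs_primitive_le_sqrt hp hpρ hy) hw hwper hwmean hx
  calc ∫ x in a..b, w x ^ 2 ≤ ∫ x in a..b, (D * ∫ x in a..b, |p x * z x|) ^ 2 := by
        refine integral_mono_on hab.le (Continuous.intervalIntegrable (by fun_prop) _ _)
          (continuous_const.intervalIntegrable _ _) fun x hx => ?_
        rw [← sq_abs (w x)]
        exact pow_le_pow_left₀ (abs_nonneg _) (hpointwise hx) 2
    _ = (b - a) * D ^ 2 * (∫ x in a..b, |p x * z x|) ^ 2 := by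
        rw [integral_const, smul_eq_mul]
        ring
    _ ≤ (b - a) * D ^ 2 * (|ρ| * ∫ x in a..b, z x ^ 2) := by
        gcongr
        refine (sq_integral_abs_mul_le hp hz hab.le).trans ?_
        gcongr
        · exact integral_nonneg hab.le fun x _ => sq_nonneg _
        · exact hpρ.trans (le_abs_self _)
    _ = _ := by ring

end PeriodicODE

/-! ### Sobolev energies and products -/

section Convolution

variable {ι G : Type*} [AddGroup G]

theorem summable_mul_of_summable_sq {f g : ι → ℝ} (hf : Summable fun i => f i ^ 2)
    (hg : Summable fun i => g i ^ 2) : Summable fun i => f i * g i := by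
  refine Summable.of_norm_bounded (hf.add hg) fun i => ?_
  rw [Real.norm_eq_abs, abs_le]
  constructor <;> nlinarith [sq_nonneg (f i - g i), sq_nonneg (f i + g i)]

theorem sq_tsum_mul_le {f g : ι → ℝ} (hf : Summable fun i => f i ^ 2)
    (hg : Summable fun i => g i ^ 2) :
    (∑' i, f i * g i) ^ 2 ≤ (∑' i, f i ^ 2) * ∑' i, g i ^ 2 := by
  refine le_of_tendsto ((summable_mul_of_summable_sq hf hg).hasSum.pow 2)
    (Filter.Eventually.of_forall fun S => (Finset.sum_mul_sq_le_sq_mul_sq S f g).trans ?_)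
  gcongr
  · exact hf.sum_le_tsum S fun i _ => sq_nonneg _
  · exact hg.sum_le_tsum S fun i _ => sq_nonneg _

theorem summable_comp_sub {f : G → ℝ} (hf : Summable f) (k : G) : Summable fun j => f (k - j) :=
  (Equiv.subLeft k).summable_iff.2 hf

theorem tsum_comp_sub (f : G → ℝ) (k : G) : ∑' j, f (k - j) = ∑' j, f j :=
  (Equiv.subLeft k).tsum_eq f

theorem summable_convolution {f g : G → ℝ} (hf : Summable fun i => f i ^ 2)
    (hg : Summable fun i => g i ^ 2) (k : G) : Summable fun j => f j * g (k - j) :=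
  summable_mul_of_summable_sq hf (summable_comp_sub hg k)

theorem sq_tsum_convolution_le {f g : G → ℝ} (hf : Summable fun i => f i ^ 2)
    (hg : Summable fun i => g i ^ 2) (k : G) :
    (∑' j, f j * g (k - j)) ^ 2 ≤ (∑' j, f j ^ 2) * ∑' j, g j ^ 2 := by
  rw [← tsum_comp_sub (fun j => g j ^ 2) k]
  exact sq_tsum_mul_le hf (summable_comp_sub hg k)

theorem summable_prod_convolution {p r : G → ℝ} (hp : Summable p) (hr : Summable r) (hp0 : 0 ≤ p)
    (hr0 : 0 ≤ r) : Summable fun x : G × G => p x.2 * r (x.1 - x.2) :=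
  ((Equiv.prodComm G G).trans (Equiv.prodShear (Equiv.refl G) fun j =>
    Equiv.subRight j)).summable_iff.2 (hp.mul_of_nonneg hr hp0 hr0)

theorem hasSum_tsum_convolution {p r : G → ℝ} (hp : Summable p) (hr : Summable r) (hp0 : 0 ≤ p)
    (hr0 : 0 ≤ r) : HasSum (fun k => ∑' j, p j * r (k - j)) ((∑' j, p j) * ∑' j, r j) := by
  have hsum := summable_prod_convolution hp hr hp0 hr0
  have htsum : (∑' j, p j) * ∑' j, r j = ∑' x : G × G, p x.2 * r (x.1 - x.2) := by
    rw [hp.tsum_mul_tsum hr (hp.mul_of_nonneg hr hp0 hr0), ← ((Equiv.prodComm G G).trans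
      (Equiv.prodShear (Equiv.refl G) fun j => Equiv.subRight j)).tsum_eq]
    rfl
  rw [htsum]
  exact hsum.hasSum.prod_fiberwise fun k => (hsum.prod_factor k).hasSum

end Convolution

section Energy

/-- The square `∑ (1 + k²)^s |û(k)|²` of the Sobolev norm, up to the factor `2π`. As an infinite
sum of reals it has the junk value `0` when it diverges, see `FiniteEnergy`. -/
noncomputable def energy (s : ℝ) (u : Coeffs) : ℝ := ∑' k : ℤ, (1 + (k : ℝ) ^ 2) ^ s * ‖u k‖ ^ 2

/-- Membership in `H^s`: the sum defining `energy s u` converges. -/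
def FiniteEnergy (s : ℝ) (u : Coeffs) : Prop :=
  Summable fun k : ℤ => (1 + (k : ℝ) ^ 2) ^ s * ‖u k‖ ^ 2

variable {u : Coeffs} {s t : ℝ}

theorem one_le_one_add_sq (k : ℤ) : (1 : ℝ) ≤ 1 + (k : ℝ) ^ 2 := by
  linarith [sq_nonneg (k : ℝ)]

theorem one_add_sq_pos (k : ℤ) : (0 : ℝ) < 1 + (k : ℝ) ^ 2 := by
  linarith [sq_nonneg (k : ℝ)]

theorem energy_term_nonneg (s : ℝ) (u : Coeffs) (k : ℤ) :
    0 ≤ (1 + (k : ℝ) ^ 2) ^ s * ‖u k‖ ^ 2 := by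
  positivity

theorem energy_nonneg (s : ℝ) (u : Coeffs) : 0 ≤ energy s u := tsum_nonneg (energy_term_nonneg s u)

theorem energy_term_mono (hst : s ≤ t) (u : Coeffs) (k : ℤ) :
    (1 + (k : ℝ) ^ 2) ^ s * ‖u k‖ ^ 2 ≤ (1 + (k : ℝ) ^ 2) ^ t * ‖u k‖ ^ 2 := by
  gcongr
  exact one_le_one_add_sq k

theorem FiniteEnergy.mono (hst : s ≤ t) (h : FiniteEnergy t u) : FiniteEnergy s u :=
  Summable.of_nonneg_of_le (energy_term_nonneg s u) (energy_term_mono hst u) h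

theorem energy_mono (hst : s ≤ t) (h : FiniteEnergy t u) : energy s u ≤ energy t u :=
  (h.mono hst).tsum_le_tsum (energy_term_mono hst u) h

theorem energy_zero (u : Coeffs) : energy 0 u = ∑' k, ‖u k‖ ^ 2 := by simp [energy]

theorem finiteEnergy_zero_iff : FiniteEnergy 0 u ↔ Summable fun k => ‖u k‖ ^ 2 := by
  simp [FiniteEnergy]

theorem finiteEnergy_of_support_finite (s : ℝ) (hu : u.support.Finite) : FiniteEnergy s u :=
  summable_of_hasFiniteSupport (hu.subset fun k hk h => hk (by simp [h]))

end Energy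

section Products

variable {u v w : Coeffs}

theorem summable_norm_mul_norm (hu : FiniteEnergy 0 u) (hv : FiniteEnergy 0 v) (k : ℤ) :
    Summable fun j => ‖u j‖ * ‖v (k - j)‖ :=
  summable_convolution (finiteEnergy_zero_iff.1 hu) (finiteEnergy_zero_iff.1 hv) k

theorem summable_mul_term (hu : FiniteEnergy 0 u) (hv : FiniteEnergy 0 v) (k : ℤ) :
    Summable fun j => u j * v (k - j) :=
  .of_norm (by simpa only [norm_mul] using summable_norm_mul_norm hu hv k)

theorem norm_mul_le_tsum (hu : FiniteEnergy 0 u) (hv : FiniteEnergy 0 v) (k : ℤ) :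
    ‖mul u v k‖ ≤ ∑' j, ‖u j‖ * ‖v (k - j)‖ := by
  have h := summable_norm_mul_norm hu hv k
  simp only [← norm_mul] at h ⊢
  exact norm_tsum_le_tsum_norm h

theorem norm_mul_sq_le (hu : FiniteEnergy 0 u) (hv : FiniteEnergy 0 v) (k : ℤ) :
    ‖mul u v k‖ ^ 2 ≤ energy 0 u * energy 0 v := by
  rw [energy_zero, energy_zero]
  exact (pow_le_pow_left₀ (norm_nonneg _) (norm_mul_le_tsum hu hv k) 2).trans
    (sq_tsum_convolution_le (finiteEnergy_zero_iff.1 hu) (finiteEnergy_zero_iff.1 hv) k)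

theorem mul_comm_coeffs (u v : Coeffs) : mul u v = mul v u := by
  ext k
  rw [mul, mul, ← (Equiv.subLeft k).tsum_eq]
  refine tsum_congr fun j => ?_
  simp [mul_comm]

theorem mul_add_coeffs (hu : FiniteEnergy 0 u) (hv : FiniteEnergy 0 v) (hw : FiniteEnergy 0 w) :
    mul u (v + w) = mul u v + mul u w := by
  ext k
  simp only [mul, Pi.add_apply, mul_add]
  exact (summable_mul_term hu hv k).tsum_add (summable_mul_term hu hw k)

theorem mul_smul_coeffs (c : ℝ) (u v : Coeffs) : mul u (c • v) = c • mul u v := by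
  ext k
  simp only [mul, Pi.smul_apply, Complex.real_smul, ← tsum_mul_left]
  refine tsum_congr fun j => ?_
  ring

end Products

section Weights

variable {u v : Coeffs} {s : ℝ}

/-- The square root `⟨k⟩^s` of the Sobolev weight `(1 + k²)^s`. -/
noncomputable def weight (s : ℝ) (k : ℤ) : ℝ := (1 + (k : ℝ) ^ 2) ^ (s / 2)

theorem weight_pos (s : ℝ) (k : ℤ) : 0 < weight s k := Real.rpow_pos_of_pos (one_add_sq_pos k) _

theorem weight_sq (s : ℝ) (k : ℤ) : weight s k ^ 2 = (1 + (k : ℝ) ^ 2) ^ s := by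
  rw [weight, ← Real.rpow_natCast, ← Real.rpow_mul (one_add_sq_pos k).le]
  norm_num

theorem weight_neg (s : ℝ) (k : ℤ) : weight s (-k) = weight s k := by simp [weight]

theorem weight_mul (s t : ℝ) (k : ℤ) : weight s k * weight t k = weight (s + t) k := by
  rw [weight, weight, weight, ← Real.rpow_add (one_add_sq_pos k), add_div]

theorem weight_zero (k : ℤ) : weight 0 k = 1 := by simp [weight]

theorem weight_mul_norm_sq (s : ℝ) (u : Coeffs) (k : ℤ) :
    (weight s k * ‖u k‖) ^ 2 = (1 + (k : ℝ) ^ 2) ^ s * ‖u k‖ ^ 2 := by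
  rw [mul_pow, weight_sq]

theorem FiniteEnergy.summable_weight_sq (hu : FiniteEnergy s u) :
    Summable fun k => (weight s k * ‖u k‖) ^ 2 := by
  simpa only [weight_mul_norm_sq] using show Summable _ from hu

theorem tsum_weight_sq (s : ℝ) (u : Coeffs) :
    ∑' k, (weight s k * ‖u k‖) ^ 2 = energy s u := by
  simp only [weight_mul_norm_sq, energy]

theorem one_add_sq_le_four_mul_max (k j : ℤ) :
    1 + (k : ℝ) ^ 2 ≤ 4 * max (1 + (j : ℝ) ^ 2) (1 + ((k - j : ℤ) : ℝ) ^ 2) := by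
  have hj := le_max_left (1 + (j : ℝ) ^ 2) (1 + ((k - j : ℤ) : ℝ) ^ 2)
  have hkj := le_max_right (1 + (j : ℝ) ^ 2) (1 + ((k - j : ℤ) : ℝ) ^ 2)
  generalize max (1 + (j : ℝ) ^ 2) (1 + ((k - j : ℤ) : ℝ) ^ 2) = m at hj hkj ⊢
  push_cast at hkj
  nlinarith [sq_nonneg ((k : ℝ) - 2 * j)]

theorem weight_le (hs : 0 ≤ s) (k j : ℤ) :
    weight s k ≤ 4 ^ (s / 2) * (weight s j + weight s (k - j)) :=
  calc weight s k
      ≤ (4 * max (1 + (j : ℝ) ^ 2) (1 + ((k - j : ℤ) : ℝ) ^ 2)) ^ (s / 2) :=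
        Real.rpow_le_rpow (one_add_sq_pos k).le (one_add_sq_le_four_mul_max k j) (by positivity)
    _ = 4 ^ (s / 2) * max (1 + (j : ℝ) ^ 2) (1 + ((k - j : ℤ) : ℝ) ^ 2) ^ (s / 2) :=
        Real.mul_rpow (by norm_num) (le_max_of_le_left (one_add_sq_pos j).le)
    _ ≤ 4 ^ (s / 2) * (weight s j + weight s (k - j)) := by
        gcongr
        rcases max_choice (1 + (j : ℝ) ^ 2) (1 + ((k - j : ℤ) : ℝ) ^ 2) with h | h <;> rw [h]
        · exact le_add_of_nonneg_right (weight_pos s (k - j)).le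
        · exact le_add_of_nonneg_left (weight_pos s j).le

theorem weight_mul_norm_mul_le (hs : 0 ≤ s) (hu : FiniteEnergy s u) (hv : FiniteEnergy s v)
    (k : ℤ) : weight s k * ‖mul u v k‖ ≤ 4 ^ (s / 2) *
      ((∑' j, weight s j * ‖u j‖ * ‖v (k - j)‖) +
        ∑' j, ‖u j‖ * (weight s (k - j) * ‖v (k - j)‖)) := by
  have hu0 := hu.mono hs
  have hv0 := hv.mono hs
  have hwu : Summable fun j => weight s j * ‖u j‖ * ‖v (k - j)‖ :=
    summable_convolution hu.summable_weight_sq (finiteEnergy_zero_iff.1 hv0) k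
  have hwv : Summable fun j => ‖u j‖ * (weight s (k - j) * ‖v (k - j)‖) :=
    summable_convolution (finiteEnergy_zero_iff.1 hu0) hv.summable_weight_sq k
  calc weight s k * ‖mul u v k‖ ≤ weight s k * ∑' j, ‖u j‖ * ‖v (k - j)‖ :=
        mul_le_mul_of_nonneg_left (norm_mul_le_tsum hu0 hv0 k) (weight_pos s k).le
    _ = ∑' j, weight s k * (‖u j‖ * ‖v (k - j)‖) := by rw [tsum_mul_left]
    _ ≤ ∑' j, 4 ^ (s / 2) * (weight s j * ‖u j‖ * ‖v (k - j)‖ +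
          ‖u j‖ * (weight s (k - j) * ‖v (k - j)‖)) := by
        refine ((summable_norm_mul_norm hu0 hv0 k).mul_left _).tsum_le_tsum (fun j => ?_)
          ((hwu.add hwv).mul_left _)
        refine (mul_le_mul_of_nonneg_right (weight_le hs k j) (by positivity)).trans_eq ?_
        ring
    _ = _ := by rw [tsum_mul_left, hwu.tsum_add hwv]

theorem weight_mul_norm_mul_sq_le (hs : 0 ≤ s) (hu : FiniteEnergy s u) (hv : FiniteEnergy s v)
    (k : ℤ) : (1 + (k : ℝ) ^ 2) ^ s * ‖mul u v k‖ ^ 2 ≤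
      2 * 4 ^ s * (energy s u * energy 0 v + energy 0 u * energy s v) := by
  have hwu := sq_tsum_convolution_le hu.summable_weight_sq
    (finiteEnergy_zero_iff.1 (hv.mono hs)) k
  have hwv := sq_tsum_convolution_le (finiteEnergy_zero_iff.1 (hu.mono hs))
    hv.summable_weight_sq k
  rw [tsum_weight_sq, ← energy_zero] at hwu hwv
  have hfour : ((4 : ℝ) ^ (s / 2)) ^ 2 = 4 ^ s := by
    rw [← Real.rpow_natCast, ← Real.rpow_mul (by norm_num)]
    norm_num
  have : 0 < weight s k := weight_pos s k
  calc (1 + (k : ℝ) ^ 2) ^ s * ‖mul u v k‖ ^ 2 = (weight s k * ‖mul u v k‖) ^ 2 :=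
        (weight_mul_norm_sq s _ k).symm
    _ ≤ _ := pow_le_pow_left₀ (by positivity) (weight_mul_norm_mul_le hs hu hv k) 2
    _ ≤ 4 ^ s * (2 * (energy s u * energy 0 v + energy 0 u * energy s v)) := by
        rw [mul_pow, hfour]
        gcongr 4 ^ s * ?_
        exact add_sq_le.trans (by linarith)
    _ = _ := by ring

theorem summable_inv_one_add_sq : Summable fun k : ℤ => (1 + (k : ℝ) ^ 2)⁻¹ := by
  refine Summable.of_norm_bounded_eventually (g := fun k : ℤ => 1 / (k : ℝ) ^ 2)
    (Real.summable_one_div_int_pow.2 one_lt_two) ?_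
  filter_upwards [(Set.finite_singleton (0 : ℤ)).compl_mem_cofinite] with k hk
  have hk0 : (k : ℝ) ≠ 0 := by simpa using hk
  rw [Real.norm_of_nonneg (by positivity), one_div]
  gcongr
  linarith

theorem tsum_inv_one_add_sq_nonneg : 0 ≤ ∑' k : ℤ, (1 + (k : ℝ) ^ 2)⁻¹ :=
  tsum_nonneg fun _ => by positivity

theorem summable_tsum_convolution_weight_neg_half (k : ℤ) :
    (Summable fun j => (weight (-(1 / 2)) j * weight (-(1 / 2)) (k - j)) ^ 2) ∧
      ∑' j, (weight (-(1 / 2)) j * weight (-(1 / 2)) (k - j)) ^ 2 ≤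
        ∑' j : ℤ, (1 + (j : ℝ) ^ 2)⁻¹ := by
  have hfour (j : ℤ) : (weight (-(1 / 2)) j ^ 2) ^ 2 = (1 + (j : ℝ) ^ 2)⁻¹ := by
    rw [weight_sq, ← Real.rpow_natCast, ← Real.rpow_mul (one_add_sq_pos j).le,
      ← Real.rpow_neg_one]
    norm_num
  have hs : Summable fun j => (weight (-(1 / 2)) j ^ 2) ^ 2 := by
    simpa only [hfour] using summable_inv_one_add_sq
  simp only [mul_pow]
  refine ⟨summable_convolution hs hs k, le_of_sq_le_sq ?_ tsum_inv_one_add_sq_nonneg⟩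
  simpa only [hfour, ← sq] using sq_tsum_convolution_le hs hs k

theorem norm_mul_sq_le_tsum_of_finiteEnergy_half (hu : FiniteEnergy (1 / 2) u)
    (hv : FiniteEnergy (1 / 2) v) (k : ℤ) :
    ‖mul u v k‖ ^ 2 ≤ (∑' j : ℤ, (1 + (j : ℝ) ^ 2)⁻¹) *
      ∑' j, (weight (1 / 2) j * ‖u j‖) ^ 2 * (weight (1 / 2) (k - j) * ‖v (k - j)‖) ^ 2 := by
  obtain ⟨hws, hwD⟩ := summable_tsum_convolution_weight_neg_half k
  have hone (i : ℤ) : weight (-(1 / 2)) i * weight (1 / 2) i = 1 := by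
    rw [weight_mul, neg_add_cancel, weight_zero]
  let g (j : ℤ) : ℝ := weight (1 / 2) j * ‖u j‖ * (weight (1 / 2) (k - j) * ‖v (k - j)‖)
  have hg : Summable fun j => g j ^ 2 := by
    simp only [g, mul_pow _ _ 2, weight_sq]
    exact (summable_prod_convolution hu hv (energy_term_nonneg _ u)
      (energy_term_nonneg _ v)).prod_factor k
  have hsplit (j : ℤ) : ‖u j‖ * ‖v (k - j)‖ =
      weight (-(1 / 2)) j * weight (-(1 / 2)) (k - j) * g j :=
    calc ‖u j‖ * ‖v (k - j)‖ = (weight (-(1 / 2)) j * weight (1 / 2) j) *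
          (weight (-(1 / 2)) (k - j) * weight (1 / 2) (k - j)) * (‖u j‖ * ‖v (k - j)‖) := by
          rw [hone, hone, one_mul, one_mul]
      _ = _ := by ring
  calc ‖mul u v k‖ ^ 2 ≤ (∑' j, ‖u j‖ * ‖v (k - j)‖) ^ 2 :=
        pow_le_pow_left₀ (norm_nonneg _) (norm_mul_le_tsum (hu.mono (by norm_num))
          (hv.mono (by norm_num)) k) 2
    _ ≤ (∑' j, (weight (-(1 / 2)) j * weight (-(1 / 2)) (k - j)) ^ 2) * ∑' j, g j ^ 2 := by
        simp only [hsplit]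
        exact sq_tsum_mul_le hws hg
    _ ≤ _ := by
        simp only [← mul_pow _ _ 2] at hwD ⊢
        gcongr

theorem finiteEnergy_zero_mul (hu : FiniteEnergy (1 / 2) u) (hv : FiniteEnergy (1 / 2) v) :
    FiniteEnergy 0 (mul u v) :=
  finiteEnergy_zero_iff.2 <| Summable.of_nonneg_of_le (fun _ => sq_nonneg _)
    (norm_mul_sq_le_tsum_of_finiteEnergy_half hu hv)
    ((hasSum_tsum_convolution hu.summable_weight_sq hv.summable_weight_sq (fun _ => sq_nonneg _)
      fun _ => sq_nonneg _).summable.mul_left _)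

theorem energy_zero_mul_le (hu : FiniteEnergy (1 / 2) u) (hv : FiniteEnergy (1 / 2) v) :
    energy 0 (mul u v) ≤
      (∑' j : ℤ, (1 + (j : ℝ) ^ 2)⁻¹) * (energy (1 / 2) u * energy (1 / 2) v) := by
  have hconv := (hasSum_tsum_convolution hu.summable_weight_sq hv.summable_weight_sq
    (fun _ => sq_nonneg _) fun _ => sq_nonneg _).mul_left (∑' j : ℤ, (1 + (j : ℝ) ^ 2)⁻¹)
  rw [tsum_weight_sq, tsum_weight_sq] at hconv
  rw [energy_zero, ← hconv.tsum_eq]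
  exact (finiteEnergy_zero_iff.1 (finiteEnergy_zero_mul hu hv)).tsum_le_tsum
    (norm_mul_sq_le_tsum_of_finiteEnergy_half hu hv) hconv.summable

end Weights

/-! ### Trigonometric polynomials -/

section CoefficientOperators

variable {f g : Coeffs}

/-- The antiderivative of mean zero: `(∂⁻¹ f)^(k) = f̂(k) / (i k)` for `k ≠ 0`, and the junk value
`0⁻¹ = 0` annihilates the mean of `f`. -/
noncomputable def antideriv (f : Coeffs) : Coeffs := fun k => (Complex.I * k)⁻¹ * f k

/-- The projection `f ↦ f - P₀ f` onto mean zero. -/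
noncomputable def removeMean (f : Coeffs) : Coeffs := f - mean f

theorem removeMean_apply (f : Coeffs) (k : ℤ) : removeMean f k = if k = 0 then 0 else f k := by
  simp only [removeMean, mean, Pi.sub_apply]
  split_ifs <;> simp

theorem deriv_antideriv (f : Coeffs) : deriv (antideriv f) = removeMean f := by
  ext k
  rw [removeMean_apply, deriv, antideriv]
  split_ifs with hk
  · simp [hk]
  · rw [← mul_assoc, mul_inv_cancel₀ (by simp [hk]), one_mul]

theorem deriv_smul (c : ℝ) (f : Coeffs) : deriv (c • f) = c • deriv f := by
  ext k
  simp [deriv]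
  ring

/-- The symmetry of the Fourier coefficients of a real-valued distribution. -/
def IsRealValued (f : Coeffs) : Prop := ∀ k, f (-k) = conj (f k)

theorem IsRealValued.mul (hf : IsRealValued f) (hg : IsRealValued g) :
    IsRealValued (TorusSobolev.mul f g) := by
  intro k
  rw [TorusSobolev.mul, TorusSobolev.mul, Complex.conj_tsum, ← (Equiv.neg ℤ).tsum_eq]
  refine tsum_congr fun j => ?_
  rw [map_mul, ← hf, ← hg]
  simp only [Equiv.neg_apply]
  congr 2
  ring

theorem IsRealValued.deriv (hf : IsRealValued f) : IsRealValued (TorusSobolev.deriv f) := by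
  intro k
  simp [TorusSobolev.deriv, hf k]

theorem IsRealValued.antideriv (hf : IsRealValued f) :
    IsRealValued (TorusSobolev.antideriv f) := by
  intro k
  simp [TorusSobolev.antideriv, hf k]

theorem IsRealValued.removeMean (hf : IsRealValued f) :
    IsRealValued (TorusSobolev.removeMean f) := by
  intro k
  simp only [removeMean_apply, neg_eq_zero, hf k]
  split_ifs <;> simp

theorem mul_self_zero (hf : IsRealValued f) : mul f f 0 = (energy 0 f : ℂ) := by
  rw [mul, energy_zero, Complex.ofReal_tsum]
  refine tsum_congr fun k => ?_
  rw [zero_sub, hf, Complex.mul_conj, Complex.normSq_eq_norm_sq]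

end CoefficientOperators

section RealTrigPoly

variable {f g : Coeffs}

/-- The coefficients of a real trigonometric polynomial. -/
structure IsRealTrigPoly (f : Coeffs) : Prop where
  finite_support : f.support.Finite
  real_valued : IsRealValued f

theorem IsRealTrigPoly.mul (hf : IsRealTrigPoly f) (hg : IsRealTrigPoly g) :
    IsRealTrigPoly (TorusSobolev.mul f g) where
  finite_support := by
    refine (hf.finite_support.image2 (· + ·) hg.finite_support).subset fun k hk => ?_
    by_contra hk'
    refine hk ?_
    rw [TorusSobolev.mul, ← tsum_zero (α := ℂ) (β := ℤ)]
    refine tsum_congr fun j => ?_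
    by_contra hj
    obtain ⟨hfj, hgj⟩ := mul_ne_zero_iff.1 hj
    exact hk' ⟨j, hfj, k - j, hgj, by simp⟩
  real_valued := hf.real_valued.mul hg.real_valued

theorem IsRealTrigPoly.deriv (hf : IsRealTrigPoly f) : IsRealTrigPoly (TorusSobolev.deriv f) where
  finite_support := hf.finite_support.subset fun k hk h => hk (by simp [TorusSobolev.deriv, h])
  real_valued := hf.real_valued.deriv

theorem IsRealTrigPoly.antideriv (hf : IsRealTrigPoly f) :
    IsRealTrigPoly (TorusSobolev.antideriv f) where
  finite_support :=
    hf.finite_support.subset fun k hk h => hk (by simp [TorusSobolev.antideriv, h])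
  real_valued := hf.real_valued.antideriv

theorem IsRealTrigPoly.removeMean (hf : IsRealTrigPoly f) :
    IsRealTrigPoly (TorusSobolev.removeMean f) where
  finite_support := hf.finite_support.subset fun k hk h =>
    hk (by rw [removeMean_apply, h, ite_self])
  real_valued := hf.real_valued.removeMean

theorem IsRealTrigPoly.add (hf : IsRealTrigPoly f) (hg : IsRealTrigPoly g) :
    IsRealTrigPoly (f + g) where
  finite_support :=
    (hf.finite_support.union hg.finite_support).subset (Function.support_add _ _)
  real_valued k := by rw [Pi.add_apply, Pi.add_apply, hf.real_valued, hg.real_valued, map_add]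

theorem IsRealTrigPoly.smul (c : ℝ) (hf : IsRealTrigPoly f) : IsRealTrigPoly (c • f) where
  finite_support := hf.finite_support.subset (Function.support_const_smul_subset _ _)
  real_valued k := by simp [hf.real_valued k]

end RealTrigPoly

section Evaluation

open Real intervalIntegral

variable {f g : Coeffs}

/-- The function with Fourier coefficients `f`, for `f` of finite support. -/
noncomputable def trig (f : Coeffs) (x : ℝ) : ℂ := ∑' k : ℤ, f k * Complex.exp (Complex.I * k * x)

theorem summable_trig (hf : f.support.Finite) (x : ℝ) :
    Summable fun k : ℤ => f k * Complex.exp (Complex.I * k * x) :=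
  summable_of_hasFiniteSupport (hf.subset fun k hk h => hk (by simp [h]))

theorem trig_eq_sum (hf : f.support.Finite) (x : ℝ) :
    trig f x = ∑ k ∈ hf.toFinset, f k * Complex.exp (Complex.I * k * x) :=
  tsum_eq_sum fun k hk => by
    have : f k = 0 := by simpa using hk
    simp [this]

theorem trig_mul (hf : f.support.Finite) (hg : g.support.Finite) (x : ℝ) :
    trig (mul f g) x = trig f x * trig g x := by
  have hF : Summable (Function.uncurry fun k j : ℤ =>
      f j * g (k - j) * Complex.exp (Complex.I * k * x)) := by
    refine summable_of_hasFiniteSupport (((hf.prod hg).image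
      fun p : ℤ × ℤ => (p.1 + p.2, p.1)).subset ?_)
    rintro ⟨k, j⟩ h
    have hfj : f j ≠ 0 := fun h' => h (by simp [Function.uncurry, h'])
    have hgj : g (k - j) ≠ 0 := fun h' => h (by simp [Function.uncurry, h'])
    exact ⟨(j, k - j), ⟨hfj, hgj⟩, by simp⟩
  calc trig (mul f g) x
      = ∑' k : ℤ, ∑' j : ℤ, f j * g (k - j) * Complex.exp (Complex.I * k * x) := by
        simp only [trig, mul, tsum_mul_right]
    _ = ∑' j : ℤ, ∑' k : ℤ, f j * g (k - j) * Complex.exp (Complex.I * k * x) := hF.tsum_comm.symm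
    _ = ∑' j : ℤ, f j * Complex.exp (Complex.I * j * x) * trig g x := by
        refine tsum_congr fun j => ?_
        rw [trig, ← tsum_mul_left, ← (Equiv.addRight j).tsum_eq]
        refine tsum_congr fun k => ?_
        simp only [Equiv.coe_addRight, add_sub_cancel_right, Int.cast_add]
        rw [mul_add, add_mul, Complex.exp_add]
        ring
    _ = trig f x * trig g x := by rw [tsum_mul_right, ← trig]

theorem hasDerivAt_trig (hf : f.support.Finite) (x : ℝ) :
    HasDerivAt (trig f) (trig (deriv f) x) x := by
  have hderiv : trig (deriv f) x =
      ∑ k ∈ hf.toFinset, deriv f k * Complex.exp (Complex.I * k * x) :=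
    tsum_eq_sum fun k hk => by
      have : f k = 0 := by simpa using hk
      simp [deriv, this]
  rw [funext (trig_eq_sum hf), hderiv]
  refine HasDerivAt.fun_sum fun k _ => ?_
  have hphase : HasDerivAt (fun y : ℝ => Complex.I * k * (y : ℂ)) (Complex.I * k * 1) x :=
    Complex.ofRealCLM.hasDerivAt.const_mul _
  refine (hphase.cexp.const_mul (f k)).congr_deriv ?_
  rw [deriv]
  ring

theorem exp_I_mul_two_pi (k : ℤ) : Complex.exp (Complex.I * k * (2 * π : ℝ)) = 1 := by
  rw [← Complex.exp_int_mul_two_pi_mul_I k]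
  congr 1
  push_cast
  ring

theorem trig_two_pi (f : Coeffs) : trig f (2 * π : ℝ) = trig f 0 :=
  tsum_congr fun k => by rw [exp_I_mul_two_pi]; simp

theorem integral_trig (hf : f.support.Finite) :
    ∫ x in (0 : ℝ)..(2 * π), trig f x = 2 * π * f 0 := by
  have hexp (k : ℤ) : ∫ x in (0 : ℝ)..(2 * π), Complex.exp (Complex.I * k * x) =
      if k = 0 then 2 * π else 0 := by
    split_ifs with hk
    · simp [hk]
    · rw [integral_exp_mul_complex (by simp [hk]), exp_I_mul_two_pi]
      simp
  simp_rw [trig_eq_sum hf]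
  rw [integral_finsetSum fun k _ => Continuous.intervalIntegrable (by fun_prop) _ _]
  simp_rw [integral_const_mul, hexp]
  rw [Finset.sum_eq_single 0 (fun k _ hk => by simp [hk]) fun h => by
    have h0 : f 0 = 0 := by simpa using h
    simp [h0]]
  simp [mul_comm]

/-- The real trigonometric polynomial with Fourier coefficients `f`, if `IsRealTrigPoly f`;
the real part of `trig f` in general. -/
noncomputable def rtrig (f : Coeffs) (x : ℝ) : ℝ := (trig f x).re

theorem rtrig_two_pi (f : Coeffs) : rtrig f (2 * π) = rtrig f 0 := by
  rw [rtrig, trig_two_pi, rtrig]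

theorem ofReal_rtrig (hf : IsRealValued f) (x : ℝ) : (rtrig f x : ℂ) = trig f x := by
  refine Complex.conj_eq_iff_re.1 ?_
  rw [trig, Complex.conj_tsum, ← (Equiv.neg ℤ).tsum_eq]
  refine tsum_congr fun k => ?_
  rw [map_mul, ← hf, ← Complex.exp_conj]
  simp

theorem rtrig_mul (hf : IsRealTrigPoly f) (hg : IsRealTrigPoly g) (x : ℝ) :
    rtrig (mul f g) x = rtrig f x * rtrig g x := by
  apply Complex.ofReal_injective
  push_cast
  rw [ofReal_rtrig hf.real_valued, ofReal_rtrig hg.real_valued,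
    ofReal_rtrig (hf.mul hg).real_valued, trig_mul hf.finite_support hg.finite_support]

theorem hasDerivAt_rtrig (hf : f.support.Finite) (x : ℝ) :
    HasDerivAt (rtrig f) (rtrig (deriv f) x) x :=
  Complex.reCLM.hasFDerivAt.comp_hasDerivAt x (hasDerivAt_trig hf x)

theorem continuous_rtrig (hf : f.support.Finite) : Continuous (rtrig f) :=
  continuous_iff_continuousAt.2 fun x => (hasDerivAt_rtrig hf x).continuousAt

theorem integral_rtrig (hf : f.support.Finite) :
    ∫ x in (0 : ℝ)..(2 * π), rtrig f x = 2 * π * (f 0).re := by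
  have hcont : Continuous (trig f) :=
    continuous_iff_continuousAt.2 fun x => (hasDerivAt_trig hf x).continuousAt
  have h := Complex.reCLM.intervalIntegral_comp_comm
    (hcont.intervalIntegrable (μ := MeasureTheory.volume) 0 (2 * π))
  rw [integral_trig hf] at h
  simpa [rtrig] using h

theorem integral_rtrig_sq (hf : IsRealTrigPoly f) :
    ∫ x in (0 : ℝ)..(2 * π), rtrig f x ^ 2 = 2 * π * energy 0 f := by
  simp_rw [sq, ← rtrig_mul hf hf]
  rw [integral_rtrig (hf.mul hf).finite_support, mul_self_zero hf.real_valued, Complex.ofReal_re]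

theorem rtrig_removeMean (hf : f.support.Finite) (x : ℝ) :
    rtrig (removeMean f) x = rtrig f x - (f 0).re := by
  have h : trig (removeMean f) x = trig f x - f 0 := by
    rw [trig, trig, (summable_trig hf x).tsum_eq_add_tsum_ite 0]
    simp only [removeMean_apply, ite_mul, zero_mul, Int.cast_zero, mul_zero, Complex.exp_zero]
    ring
  rw [rtrig, h, Complex.sub_re, rtrig]

theorem rtrig_add (hf : f.support.Finite) (hg : g.support.Finite) (x : ℝ) :
    rtrig (f + g) x = rtrig f x + rtrig g x := by
  rw [rtrig, rtrig, rtrig, ← Complex.add_re]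
  congr 1
  simp only [trig, Pi.add_apply, add_mul]
  exact (summable_trig hf x).tsum_add (summable_trig hg x)

theorem rtrig_smul (c : ℝ) (f : Coeffs) (x : ℝ) : rtrig (c • f) x = c * rtrig f x := by
  rw [rtrig, rtrig, trig, trig, ← Complex.re_ofReal_mul, ← tsum_mul_left]
  congr 1
  refine tsum_congr fun k => ?_
  simp [mul_assoc]

end Evaluation

section Consequences

open Real intervalIntegral

variable {f : Coeffs}

/-- `∫ f² f' = 0`, because `f² f' = (f³ / 3)'`. -/
theorem re_mul_mul_deriv_zero (hf : IsRealTrigPoly f) :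
    (mul (mul f f) (deriv f) 0).re = 0 := by
  have hfff := (hf.mul hf).mul hf.deriv
  have hderiv (x : ℝ) : HasDerivAt (fun x => rtrig f x ^ 3 / 3)
      (rtrig (mul (mul f f) (deriv f)) x) x := by
    refine (((hasDerivAt_rtrig hf.finite_support x).pow 3).div_const 3).congr_deriv ?_
    rw [rtrig_mul (hf.mul hf) hf.deriv, rtrig_mul hf hf]
    push_cast
    ring
  have hintegral : ∫ x in (0 : ℝ)..(2 * π), rtrig (mul (mul f f) (deriv f)) x = 0 := by
    rw [integral_eq_sub_of_hasDerivAt (fun x _ => hderiv x)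
      ((continuous_rtrig hfff.finite_support).intervalIntegrable _ _), rtrig_two_pi, sub_self]
  rw [integral_rtrig hfff.finite_support] at hintegral
  exact (mul_eq_zero.1 hintegral).resolve_left two_pi_pos.ne'

/-- A function of mean zero vanishes somewhere, so its square can be close to a nonzero constant
only if its derivative is large. -/
theorem energy_zero_pow_three_le (hf : IsRealTrigPoly f) (h0 : f 0 = 0) :
    energy 0 f ^ 3 ≤
      9 / 4 * (2 * π) ^ 2 * (energy 0 (removeMean (mul f f)) * energy 0 (deriv f)) := by
  have h := mean_sq_pow_three_le (hasDerivAt_rtrig hf.finite_support)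
    (continuous_rtrig hf.deriv.finite_support) two_pi_pos
    (by rw [integral_rtrig hf.finite_support, h0]; simp)
    (by rw [integral_rtrig_sq hf, sub_zero])
  have hsub (x : ℝ) : rtrig f x ^ 2 - energy 0 f = rtrig (removeMean (mul f f)) x := by
    rw [rtrig_removeMean (hf.mul hf).finite_support, rtrig_mul hf hf,
      mul_self_zero hf.real_valued, Complex.ofReal_re, sq]
  simp_rw [hsub] at h
  rw [integral_rtrig_sq hf.deriv, integral_rtrig_sq (hf.mul hf).removeMean] at h
  linarith

/-- The equation `v + 2 ∂⁻¹(a v) = z` is an ordinary differential equation for `w = -2 ∂⁻¹(a v)`,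
namely `w' = c - 2 a (w + z)` with `c` constant. -/
theorem exists_energy_zero_antideriv_mul_le (ρ : ℝ) : ∃ K : ℝ, 0 ≤ K ∧ ∀ a v : Coeffs,
    IsRealTrigPoly a → IsRealTrigPoly v → a 0 = 0 → energy 0 a ≤ ρ →
    energy 0 ((-2 : ℝ) • antideriv (mul a v)) ≤
      K * energy 0 (v + (2 : ℝ) • antideriv (mul a v)) := by
  obtain ⟨K, hK0, hK⟩ := exists_integral_sq_le_of_periodic_ode two_pi_pos (4 * (2 * π * ρ))
  refine ⟨K, hK0, fun a v ha hv ha0 haρ => ?_⟩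
  have hw := (ha.mul hv).antideriv.smul (-2)
  have hz := hv.add ((ha.mul hv).antideriv.smul 2)
  have h := hK (rtrig ((2 : ℝ) • a)) (rtrig ((-2 : ℝ) • antideriv (mul a v)))
    (rtrig (v + (2 : ℝ) • antideriv (mul a v))) (2 * (mul a v 0).re)
    (continuous_rtrig (ha.smul 2).finite_support) (continuous_rtrig hz.finite_support)
    (fun x => ?_) (rtrig_two_pi _) ?_ ?_ ?_
  · rw [integral_rtrig_sq hw, integral_rtrig_sq hz] at h
    exact le_of_mul_le_mul_left (by linarith) two_pi_pos
  · refine (hasDerivAt_rtrig hw.finite_support x).congr_deriv ?_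
    rw [deriv_smul, rtrig_smul, deriv_antideriv, rtrig_removeMean (ha.mul hv).finite_support,
      rtrig_mul ha hv, rtrig_add hv.finite_support ((ha.mul hv).antideriv.smul 2).finite_support,
      rtrig_smul, rtrig_smul, rtrig_smul]
    ring
  · rw [integral_rtrig (ha.smul 2).finite_support]
    simp [ha0]
  · rw [integral_rtrig hw.finite_support]
    simp [antideriv]
  · simp_rw [rtrig_smul, mul_pow]
    rw [integral_const_mul, integral_rtrig_sq ha]
    norm_num
    gcongr

end Consequences

/-! ### The a priori bound for nonnegative symbols -/

section Tail

/-- The tail `∑_{|k| > N} (1 + k²)⁻¹`. -/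
noncomputable def tail (N : ℝ) : ℝ :=
  ∑' k : ℤ, if N < |(k : ℝ)| then (1 + (k : ℝ) ^ 2)⁻¹ else 0

theorem tail_term_nonneg (N : ℝ) (k : ℤ) :
    0 ≤ if N < |(k : ℝ)| then (1 + (k : ℝ) ^ 2)⁻¹ else 0 := by
  positivity

theorem tail_term_le (N : ℝ) (k : ℤ) :
    (if N < |(k : ℝ)| then (1 + (k : ℝ) ^ 2)⁻¹ else 0) ≤ (1 + (k : ℝ) ^ 2)⁻¹ := by
  split_ifs
  · exact le_rfl
  · positivity

theorem summable_tail (N : ℝ) :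
    Summable fun k : ℤ => if N < |(k : ℝ)| then (1 + (k : ℝ) ^ 2)⁻¹ else 0 :=
  Summable.of_nonneg_of_le (tail_term_nonneg N) (tail_term_le N) summable_inv_one_add_sq

theorem tail_nonneg (N : ℝ) : 0 ≤ tail N := tsum_nonneg (tail_term_nonneg N)

theorem tendsto_tail : Filter.Tendsto tail Filter.atTop (nhds 0) := by
  rw [← tsum_zero (α := ℝ) (β := ℤ)]
  refine tendsto_tsum_of_dominated_convergence summable_inv_one_add_sq (fun k => ?_)
    (Filter.Eventually.of_forall fun N k => ?_)
  · refine tendsto_const_nhds.congr' ?_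
    filter_upwards [Filter.eventually_ge_atTop |(k : ℝ)|] with N hN
    rw [if_neg (not_lt.2 hN)]
  · rw [Real.norm_of_nonneg (tail_term_nonneg N k)]
    exact tail_term_le N k

theorem exists_tail_half_le {ε : ℝ} (hε : 0 < ε) : ∃ N₀ : ℝ, ∀ N, N₀ ≤ N → tail (N / 2) ≤ ε :=
  Filter.eventually_atTop.1 ((tendsto_tail.comp
    (Filter.tendsto_id.atTop_div_const two_pos)).eventually_le_const hε)

end Tail

section Interpolation

variable {w : Coeffs}

theorem norm_deriv_sq (w : Coeffs) (k : ℤ) : ‖deriv w k‖ ^ 2 = (k : ℝ) ^ 2 * ‖w k‖ ^ 2 := by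
  simp [deriv, mul_pow]

theorem finiteEnergy_zero_deriv (hw : FiniteEnergy 1 w) : FiniteEnergy 0 (deriv w) :=
  finiteEnergy_zero_iff.2 <| Summable.of_nonneg_of_le (fun _ => sq_nonneg _) (fun k => by
    rw [norm_deriv_sq, Real.rpow_one]
    gcongr
    linarith) hw

theorem energy_one_eq (hw : FiniteEnergy 1 w) :
    energy 1 w = energy 0 w + energy 0 (deriv w) := by
  rw [energy_zero, energy_zero, energy,
    ← (finiteEnergy_zero_iff.1 (hw.mono zero_le_one)).tsum_add
      (finiteEnergy_zero_iff.1 (finiteEnergy_zero_deriv hw))]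
  refine tsum_congr fun k => ?_
  rw [norm_deriv_sq, Real.rpow_one]
  ring

theorem le_mul_sq_add_inv {ε : ℝ} (hε : 0 < ε) (x : ℝ) : x ≤ ε * x ^ 2 + 1 / (4 * ε) := by
  have hsquare : ε * x ^ 2 + 1 / (4 * ε) - x = (2 * ε * x - 1) ^ 2 / (4 * ε) := by
    field_simp
    ring
  have : 0 ≤ (2 * ε * x - 1) ^ 2 / (4 * ε) := by positivity
  linarith

theorem energy_half_le (hw : FiniteEnergy 1 w) {ε : ℝ} (hε : 0 < ε) :
    energy (1 / 2) w ≤ ε * energy 1 w + 1 / (4 * ε) * energy 0 w := by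
  have hw0 := hw.mono zero_le_one
  rw [energy, energy, energy, ← tsum_mul_left, ← tsum_mul_left,
    ← (hw.mul_left ε).tsum_add (hw0.mul_left _)]
  refine (hw.mono (s := 1 / 2) (by norm_num)).tsum_le_tsum (fun k => ?_)
    ((hw.mul_left ε).add (hw0.mul_left _))
  rw [Real.rpow_one, Real.rpow_zero, one_mul, ← mul_assoc, ← add_mul]
  gcongr
  rw [← Real.sqrt_eq_rpow]
  exact (le_mul_sq_add_inv hε _).trans_eq (by rw [Real.sq_sqrt (one_add_sq_pos k).le])

/-- If the linear growth of `G` in `e` is traded against an interpolation inequality for `e`, then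
`G` is bounded in terms of `μ` alone. -/
theorem le_of_interpolation {P G μ e T : ℝ} (hP : 0 ≤ P) (hμ : 0 ≤ μ) (hG : 0 ≤ G) (hT : 0 ≤ T)
    (he : ∀ ε, 0 < ε → e ≤ ε * (μ + G) + 1 / (4 * ε) * μ) (h : G ≤ P * e + T) :
    G ≤ (1 + P * (P + 1) + 2 * T) * (1 + μ) := by
  have hPe := mul_le_mul_of_nonneg_left (he (1 / (2 * (P + 1))) (by positivity)) hP
  have hexpand : P * (1 / (2 * (P + 1)) * (μ + G) + 1 / (4 * (1 / (2 * (P + 1)))) * μ) =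
      P / (P + 1) * ((μ + G) / 2) + P * (P + 1) / 2 * μ := by
    field_simp
    ring
  have habsorb : P / (P + 1) * ((μ + G) / 2) ≤ 1 * ((μ + G) / 2) := by
    gcongr
    rw [div_le_one (by positivity)]
    linarith
  have : 0 ≤ P * (P + 1) := by positivity
  have : 0 ≤ T * μ := by positivity
  linarith

end Interpolation

section CrossTerm

variable {w z : Coeffs}

/-- The cross terms `2wz + z²` in the expansion of `(w + z)²`. -/
noncomputable def crossTerm (w z : Coeffs) : Coeffs := (2 : ℝ) • mul w z + mul z z

theorem finiteEnergy_zero_add (hw : FiniteEnergy 0 w) (hz : FiniteEnergy 0 z) :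
    FiniteEnergy 0 (w + z) := by
  rw [finiteEnergy_zero_iff] at hw hz ⊢
  refine Summable.of_nonneg_of_le (fun k => sq_nonneg _) (fun k => ?_) ((hw.add hz).mul_left 2)
  exact (pow_le_pow_left₀ (norm_nonneg _) (norm_add_le (w k) (z k)) 2).trans add_sq_le

theorem mul_add_self (hw : FiniteEnergy 0 w) (hz : FiniteEnergy 0 z) :
    mul (w + z) (w + z) = mul w w + crossTerm w z := by
  rw [crossTerm, mul_add_coeffs (finiteEnergy_zero_add hw hz) hw hz, mul_comm_coeffs _ w,
    mul_comm_coeffs _ z, mul_add_coeffs hw hw hz, mul_add_coeffs hz hw hz, mul_comm_coeffs z w]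
  module

theorem norm_crossTerm_sq_le (w z : Coeffs) (k : ℤ) :
    ‖crossTerm w z k‖ ^ 2 ≤ 8 * ‖mul w z k‖ ^ 2 + 2 * ‖mul z z k‖ ^ 2 := by
  have h := norm_add_le ((2 : ℝ) • mul w z k) (mul z z k)
  rw [norm_smul, Real.norm_eq_abs, abs_two] at h
  refine (pow_le_pow_left₀ (norm_nonneg _) h 2).trans ?_
  linarith [add_sq_le (a := 2 * ‖mul w z k‖) (b := ‖mul z z k‖)]

theorem hasSum_crossTerm_bound (hw : FiniteEnergy (1 / 2) w) (hz : FiniteEnergy (1 / 2) z) :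
    HasSum (fun k => 8 * ‖mul w z k‖ ^ 2 + 2 * ‖mul z z k‖ ^ 2)
      (8 * energy 0 (mul w z) + 2 * energy 0 (mul z z)) := by
  rw [energy_zero, energy_zero]
  exact ((finiteEnergy_zero_iff.1 (finiteEnergy_zero_mul hw hz)).hasSum.mul_left 8).add
    ((finiteEnergy_zero_iff.1 (finiteEnergy_zero_mul hz hz)).hasSum.mul_left 2)

theorem finiteEnergy_zero_crossTerm (hw : FiniteEnergy (1 / 2) w) (hz : FiniteEnergy (1 / 2) z) :
    FiniteEnergy 0 (crossTerm w z) :=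
  finiteEnergy_zero_iff.2 <| Summable.of_nonneg_of_le (fun _ => sq_nonneg _)
    (norm_crossTerm_sq_le w z) (hasSum_crossTerm_bound hw hz).summable

theorem energy_zero_crossTerm_le (hw : FiniteEnergy (1 / 2) w) (hz : FiniteEnergy (1 / 2) z)
    {Z : ℝ} (hZ : energy (1 / 2) z ≤ Z) : energy 0 (crossTerm w z) ≤
      (∑' k : ℤ, (1 + (k : ℝ) ^ 2)⁻¹) * (8 * Z * energy (1 / 2) w + 2 * Z ^ 2) := by
  have := tsum_inv_one_add_sq_nonneg
  have hz0 := energy_nonneg (1 / 2) z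
  have := energy_nonneg (1 / 2) w
  calc energy 0 (crossTerm w z) ≤ 8 * energy 0 (mul w z) + 2 * energy 0 (mul z z) := by
        rw [energy_zero, ← (hasSum_crossTerm_bound hw hz).tsum_eq]
        exact (finiteEnergy_zero_iff.1 (finiteEnergy_zero_crossTerm hw hz)).tsum_le_tsum
          (norm_crossTerm_sq_le w z) (hasSum_crossTerm_bound hw hz).summable
    _ ≤ 8 * ((∑' k : ℤ, (1 + (k : ℝ) ^ 2)⁻¹) * (energy (1 / 2) w * Z)) +
          2 * ((∑' k : ℤ, (1 + (k : ℝ) ^ 2)⁻¹) * (Z * Z)) := by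
        gcongr
        · exact (energy_zero_mul_le hw hz).trans (by gcongr)
        · exact (energy_zero_mul_le hz hz).trans (by gcongr; exact hz0.trans hZ)
    _ = _ := by ring

end CrossTerm

section EnergyInequalities

variable {b : ℤ → ℝ} {w q z : Coeffs} {C₀ Z : ℝ}

theorem norm_ofReal_mul_add_sq_le {b C : ℝ} (hb : 0 ≤ b) (hbC : b ≤ C) (m q : ℂ) :
    ‖b * (m + q)‖ ^ 2 ≤ C ^ 2 * ‖q‖ ^ 2 + 2 * C * (m * conj (b * (m + q))).re := by
  have hC : 0 ≤ C := hb.trans hbC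
  have hm : (m * conj (b * (m + q))).re = b * ‖m + q‖ ^ 2 - b * (q * conj (m + q)).re := by
    rw [← Complex.normSq_eq_norm_sq]
    simp only [map_mul, Complex.conj_ofReal, map_add, Complex.normSq_apply, Complex.mul_re,
      Complex.mul_im, Complex.add_re, Complex.add_im, Complex.conj_re, Complex.conj_im,
      Complex.ofReal_re, Complex.ofReal_im]
    ring
  have hq : (q * conj (m + q)).re ≤ ‖q‖ * ‖m + q‖ := by
    simpa only [norm_mul, RCLike.norm_conj] using Complex.re_le_norm (q * conj (m + q))
  have hCb := mul_le_mul_of_nonneg_left hq (mul_nonneg hC hb)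
  have hbb : b * b * ‖m + q‖ ^ 2 ≤ C * b * ‖m + q‖ ^ 2 := by gcongr
  rw [norm_mul, Complex.norm_real, Real.norm_of_nonneg hb, hm]
  nlinarith [sq_nonneg (C * ‖q‖ - b * ‖m + q‖)]

/-- The energy inequality for `w_x = -B(w² + q)`, obtained by pairing with `w²`: since
`∫ w² w_x = 0`, only `q` contributes. -/
theorem energy_zero_deriv_le (hb0 : ∀ k, 0 ≤ b k) (hbC : ∀ k, b k ≤ C₀) (hw : IsRealTrigPoly w)
    (hq : FiniteEnergy 0 q) (h : ∀ k ≠ 0, deriv w k = -(b k * (mul w w k + q k))) :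
    energy 0 (deriv w) ≤ C₀ ^ 2 * energy 0 q := by
  have hfinite {f : Coeffs} (hf : IsRealTrigPoly f) : FiniteEnergy 0 f :=
    finiteEnergy_of_support_finite 0 hf.finite_support
  have hpair : HasSum (fun k => (mul w w k * conj (deriv w k)).re) 0 := by
    have hsum := (summable_mul_term (hfinite (hw.mul hw)) (hfinite hw.deriv) 0).hasSum
    have hre := Complex.reCLM.hasSum hsum
    rw [Complex.reCLM_apply] at hre
    rw [← re_mul_mul_deriv_zero hw]
    refine hre.congr_fun fun k => ?_
    rw [zero_sub, hw.deriv.real_valued, Complex.reCLM_apply]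
  have hbound := ((finiteEnergy_zero_iff.1 hq).hasSum.mul_left (C₀ ^ 2)).sub
    (hpair.mul_left (2 * C₀))
  rw [mul_zero, sub_zero, ← energy_zero] at hbound
  rw [energy_zero, ← hbound.tsum_eq]
  refine (finiteEnergy_zero_iff.1 (hfinite hw.deriv)).tsum_le_tsum (fun k => ?_) hbound.summable
  by_cases hk : k = 0
  · have hk0 : deriv w k = 0 := by simp [hk, deriv]
    rw [hk0, norm_zero, map_zero, mul_zero, Complex.zero_re, mul_zero, sub_zero,
      zero_pow two_ne_zero]
    positivity
  · have := norm_ofReal_mul_add_sq_le (hb0 k) (hbC k) (mul w w k) (q k)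
    rw [h k hk, norm_neg, map_neg, mul_neg, Complex.neg_re]
    linarith

theorem norm_mul_self_sq_le_of_finiteEnergy_one (hw : FiniteEnergy 1 w) (k : ℤ) :
    ‖mul w w k‖ ^ 2 ≤ 16 * (energy 1 w * energy 0 w) * (1 + (k : ℝ) ^ 2)⁻¹ := by
  have h := weight_mul_norm_mul_sq_le zero_le_one hw hw k
  rw [Real.rpow_one, Real.rpow_one] at h
  rw [← div_eq_mul_inv, le_div_iff₀ (one_add_sq_pos k)]
  linarith

theorem energy_zero_removeMean_mul_self_le {N : ℝ} (hw : FiniteEnergy 1 w) (hq : FiniteEnergy 0 q)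
    (h : ∀ k : ℤ, k ≠ 0 → |(k : ℝ)| ≤ N → deriv w k = -(mul w w k + q k)) :
    energy 0 (removeMean (mul w w)) ≤ 2 * energy 0 (deriv w) + 2 * energy 0 q +
      16 * (energy 1 w * energy 0 w) * tail N := by
  have := energy_nonneg 0 w
  have := energy_nonneg 1 w
  have hterm (k : ℤ) : ‖removeMean (mul w w) k‖ ^ 2 ≤ 2 * ‖deriv w k‖ ^ 2 + 2 * ‖q k‖ ^ 2 +
      16 * (energy 1 w * energy 0 w) *
        (if N < |(k : ℝ)| then (1 + (k : ℝ) ^ 2)⁻¹ else 0) := by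
    rw [removeMean_apply]
    split_ifs with hk hN hN
    · rw [norm_zero, zero_pow two_ne_zero]; positivity
    · rw [norm_zero, zero_pow two_ne_zero]; positivity
    · have : 0 ≤ 2 * ‖deriv w k‖ ^ 2 + 2 * ‖q k‖ ^ 2 := by positivity
      linarith [norm_mul_self_sq_le_of_finiteEnergy_one hw k]
    · have heq : mul w w k = -deriv w k - q k := by rw [h k hk (not_lt.1 hN)]; ring
      have hle : ‖mul w w k‖ ≤ ‖deriv w k‖ + ‖q k‖ := by
        rw [heq]
        exact (norm_sub_le _ _).trans (by rw [norm_neg])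
      linarith [(pow_le_pow_left₀ (norm_nonneg _) hle 2).trans add_sq_le]
  have hbound := (((finiteEnergy_zero_iff.1 (finiteEnergy_zero_deriv hw)).hasSum.mul_left 2).add
    ((finiteEnergy_zero_iff.1 hq).hasSum.mul_left 2)).add
    ((summable_tail N).hasSum.mul_left (16 * (energy 1 w * energy 0 w)))
  rw [energy_zero, energy_zero, energy_zero q, tail, ← hbound.tsum_eq]
  exact (Summable.of_nonneg_of_le (fun _ => sq_nonneg _) hterm hbound.summable).tsum_le_tsum
    hterm hbound.summable

theorem exists_energy_zero_deriv_le (C₀ : ℝ) (hZ : 0 ≤ Z) : ∃ C₁ : ℝ, 0 < C₁ ∧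
    ∀ (b : ℤ → ℝ) (w z : Coeffs), (∀ k, 0 ≤ b k) → (∀ k, b k ≤ C₀) → IsRealTrigPoly w →
    FiniteEnergy (1 / 2) z → energy (1 / 2) z ≤ Z →
    (∀ k ≠ 0, deriv w k = -(b k * (mul w w k + crossTerm w z k))) →
    energy 0 (deriv w) ≤ C₁ * (1 + energy 0 w) := by
  set D : ℝ := ∑' k : ℤ, (1 + (k : ℝ) ^ 2)⁻¹
  have : 0 ≤ D := tsum_inv_one_add_sq_nonneg
  refine ⟨1 + 8 * C₀ ^ 2 * D * Z * (8 * C₀ ^ 2 * D * Z + 1) + 2 * (2 * C₀ ^ 2 * D * Z ^ 2),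
    by positivity, fun b w z hb0 hbC hw hz hzZ hder => ?_⟩
  have hfin := fun s => finiteEnergy_of_support_finite s hw.finite_support
  refine le_of_interpolation (by positivity) (energy_nonneg _ _) (energy_nonneg _ _)
    (by positivity) (fun ε hε => energy_one_eq (hfin 1) ▸ energy_half_le (hfin 1) hε) ?_
  calc energy 0 (deriv w) ≤ C₀ ^ 2 * energy 0 (crossTerm w z) :=
        energy_zero_deriv_le hb0 hbC hw (finiteEnergy_zero_crossTerm (hfin _) hz) hder
    _ ≤ C₀ ^ 2 * (D * (8 * Z * energy (1 / 2) w + 2 * Z ^ 2)) := by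
        gcongr
        exact energy_zero_crossTerm_le (hfin _) hz hzZ
    _ = _ := by ring

theorem le_max_of_pow_three_le {A C₁ C₂ τ μ G H : ℝ} (hG0 : 0 ≤ G) (hτ0 : 0 ≤ τ)
    (hA : 0 < A) (hC₁ : 0 < C₁) (hC₂ : 0 ≤ C₂)
    (hG : G ≤ C₁ * (1 + μ)) (hτ : 64 * A * C₁ * (1 + C₁) * τ ≤ 1 / 2)
    (hH : H ≤ 2 * (C₁ + C₂) * (1 + μ) + 16 * ((1 + C₁) * (1 + μ) * μ * τ))
    (hcube : μ ^ 3 ≤ A * (H * G)) : μ ≤ max 1 (16 * A * C₁ * (C₁ + C₂)) := by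
  by_contra! hlt
  obtain ⟨hμ, hμC⟩ := max_lt_iff.1 hlt
  have htwo : 1 + μ ≤ 2 * μ := by linarith
  have hGμ : G ≤ C₁ * (2 * μ) := hG.trans (by gcongr)
  have hHμ : H ≤ 2 * (C₁ + C₂) * (2 * μ) + 16 * ((1 + C₁) * (2 * μ) * μ * τ) :=
    hH.trans (by gcongr)
  have hle : μ ^ 3 ≤
      8 * A * C₁ * (C₁ + C₂) * μ ^ 2 + 64 * A * C₁ * (1 + C₁) * τ * μ ^ 3 :=
    calc μ ^ 3 ≤ A * (H * G) := hcube
      _ ≤ A * ((2 * (C₁ + C₂) * (2 * μ) + 16 * ((1 + C₁) * (2 * μ) * μ * τ)) *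
          (C₁ * (2 * μ))) := by gcongr
      _ = _ := by ring
  have hτμ : 64 * A * C₁ * (1 + C₁) * τ * μ ^ 3 ≤ 1 / 2 * μ ^ 3 := by gcongr
  have hCμ : 16 * A * C₁ * (C₁ + C₂) * μ ^ 2 < μ * μ ^ 2 := by gcongr
  linarith

theorem deriv_eq_of_fixedPoint (hz : FiniteEnergy 0 z) (hw : FiniteEnergy 0 w)
    (h : w = -antideriv (multiplier b (mul (w + z) (w + z)))) {k : ℤ} (hk : k ≠ 0) :
    deriv w k = -(b k * (mul w w k + crossTerm w z k)) := by
  have hI : Complex.I * (k : ℂ) ≠ 0 := by simp [hk]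
  rw [mul_add_self hw hz] at h
  rw [deriv, congrFun h k]
  simp only [Pi.neg_apply, antideriv, multiplier, Pi.add_apply]
  field_simp

theorem energy_zero_crossTerm_le_mul_one_add {c : ℝ} (hZ : 0 ≤ Z) (hw : FiniteEnergy 1 w)
    (hz : FiniteEnergy (1 / 2) z) (hzZ : energy (1 / 2) z ≤ Z)
    (hw1 : energy 1 w ≤ c * (1 + energy 0 w)) :
    energy 0 (crossTerm w z) ≤
      (∑' k : ℤ, (1 + (k : ℝ) ^ 2)⁻¹) * (8 * Z * c + 2 * Z ^ 2) * (1 + energy 0 w) := by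
  set D : ℝ := ∑' k : ℤ, (1 + (k : ℝ) ^ 2)⁻¹
  have : 0 ≤ D := tsum_inv_one_add_sq_nonneg
  have hμ := energy_nonneg 0 w
  calc energy 0 (crossTerm w z) ≤ D * (8 * Z * energy (1 / 2) w + 2 * Z ^ 2) :=
        energy_zero_crossTerm_le (hw.mono (by norm_num)) hz hzZ
    _ ≤ D * (8 * Z * (c * (1 + energy 0 w)) + 2 * Z ^ 2 * (1 + energy 0 w)) := by
        gcongr D * (8 * Z * ?_ + ?_)
        · exact (energy_mono (by norm_num) hw).trans hw1
        · exact le_mul_of_one_le_right (by positivity) (by linarith)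
    _ = D * (8 * Z * c + 2 * Z ^ 2) * (1 + energy 0 w) := by ring

/-- The bound for the smooth part `w` of a solution `v = w + z` of `v + ∂⁻¹ B(v²) = z`. -/
theorem exists_energy_zero_le (C₀ : ℝ) (hZ : 0 ≤ Z) : ∃ N₀ Λ : ℝ, 0 ≤ Λ ∧
    ∀ N, N₀ ≤ N → ∀ b : ℤ → ℝ, (∀ k, 0 ≤ b k) → (∀ k, b k ≤ C₀) →
    (∀ k : ℤ, |(k : ℝ)| ≤ N / 2 → b k = 1) → ∀ w z : Coeffs, IsRealTrigPoly w →
    FiniteEnergy (1 / 2) z → energy (1 / 2) z ≤ Z →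
    w = -antideriv (multiplier b (mul (w + z) (w + z))) → energy 0 w ≤ Λ := by
  obtain ⟨C₁, hC₁, hderiv⟩ := exists_energy_zero_deriv_le C₀ hZ
  set C₂ : ℝ := (∑' k : ℤ, (1 + (k : ℝ) ^ 2)⁻¹) * (8 * Z * (1 + C₁) + 2 * Z ^ 2)
  have hC₂ : 0 ≤ C₂ := mul_nonneg tsum_inv_one_add_sq_nonneg (by positivity)
  set A : ℝ := 9 / 4 * (2 * Real.pi) ^ 2
  have hA : 0 < A := by positivity
  obtain ⟨N₀, hN₀⟩ := exists_tail_half_le (ε := 1 / (128 * A * C₁ * (1 + C₁))) (by positivity)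
  refine ⟨N₀, max 1 (16 * A * C₁ * (C₁ + C₂)), by positivity,
    fun N hN b hb0 hbC hb1 w z hw hz hzZ hwz => ?_⟩
  have hfin := fun s => finiteEnergy_of_support_finite s hw.finite_support
  have hw0 : w 0 = 0 := by rw [hwz]; simp [antideriv]
  have hder : ∀ k ≠ 0, deriv w k = -(b k * (mul w w k + crossTerm w z k)) := fun k =>
    deriv_eq_of_fixedPoint (hz.mono (by norm_num)) (hfin 0) hwz
  have hG : energy 0 (deriv w) ≤ C₁ * (1 + energy 0 w) := hderiv b w z hb0 hbC hw hz hzZ hder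
  have hμ := energy_nonneg 0 w
  have hw1 : energy 1 w ≤ (1 + C₁) * (1 + energy 0 w) := by
    rw [energy_one_eq (hfin 1)]
    linarith
  have hq : energy 0 (crossTerm w z) ≤ C₂ * (1 + energy 0 w) :=
    energy_zero_crossTerm_le_mul_one_add hZ (hfin 1) hz hzZ hw1
  have hH := energy_zero_removeMean_mul_self_le (N := N / 2) (hfin 1)
    (finiteEnergy_zero_crossTerm (hfin _) hz) fun k hk hkN => by rw [hder k hk, hb1 k hkN]; simp
  have hτ := hN₀ N hN
  have := tail_nonneg (N / 2)
  rw [le_div_iff₀ (by positivity)] at hτ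
  refine le_max_of_pow_three_le (energy_nonneg _ _) (tail_nonneg (N / 2)) hA hC₁ hC₂ hG
    (by linarith) ?_ (energy_zero_pow_three_le hw hw0)
  have : energy 1 w * energy 0 w * tail (N / 2) ≤
      (1 + C₁) * (1 + energy 0 w) * energy 0 w * tail (N / 2) := by gcongr
  linarith

end EnergyInequalities

/-! ### The model space -/

section Antiderivative

variable {s : ℝ} {u v : Coeffs}

theorem energy_term_antideriv_succ_le (s : ℝ) (u : Coeffs) (k : ℤ) :
    (1 + (k : ℝ) ^ 2) ^ (s + 1) * ‖antideriv u k‖ ^ 2 ≤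
      2 * ((1 + (k : ℝ) ^ 2) ^ s * ‖u k‖ ^ 2) := by
  rcases eq_or_ne k 0 with rfl | hk
  · simp [antideriv]
  have hk1 : (1 : ℝ) ≤ (k : ℝ) ^ 2 := by
    exact_mod_cast Int.add_one_le_iff.2 (by positivity : 0 < k ^ 2)
  have hnorm : ‖antideriv u k‖ ^ 2 = ((k : ℝ) ^ 2)⁻¹ * ‖u k‖ ^ 2 := by simp [antideriv, mul_pow]
  have hquot : (1 + (k : ℝ) ^ 2) * ((k : ℝ) ^ 2)⁻¹ ≤ 2 := by
    rw [← div_eq_mul_inv, div_le_iff₀ (by linarith)]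
    linarith
  calc (1 + (k : ℝ) ^ 2) ^ (s + 1) * ‖antideriv u k‖ ^ 2
      = (1 + (k : ℝ) ^ 2) * ((k : ℝ) ^ 2)⁻¹ * ((1 + (k : ℝ) ^ 2) ^ s * ‖u k‖ ^ 2) := by
        rw [Real.rpow_add_one (one_add_sq_pos k).ne', hnorm]
        ring
    _ ≤ 2 * ((1 + (k : ℝ) ^ 2) ^ s * ‖u k‖ ^ 2) :=
        mul_le_mul_of_nonneg_right hquot (energy_term_nonneg s u k)

theorem MemHs0.antideriv (hu : MemHs0 s u) : MemHs0 (s + 1) (TorusSobolev.antideriv u) where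
  summable := .of_nonneg_of_le (energy_term_nonneg _ _) (energy_term_antideriv_succ_le s u)
    (hu.summable.mul_left 2)
  real_valued := IsRealValued.antideriv hu.real_valued
  mean_zero := by simp [TorusSobolev.antideriv]

theorem energy_antideriv_le (hu : MemHs0 s u) : energy (s + 1) (antideriv u) ≤ 2 * energy s u := by
  rw [energy, energy, ← tsum_mul_left]
  exact hu.antideriv.summable.tsum_le_tsum (energy_term_antideriv_succ_le s u)
    (hu.summable.mul_left 2)

theorem antideriv_injOn : Set.InjOn antideriv {u | u 0 = 0} := by
  intro u hu v hv h
  ext k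
  rcases eq_or_ne k 0 with rfl | hk
  · rw [hu, hv]
  · exact mul_left_cancel₀ (inv_ne_zero (by simp [hk])) (congrFun h k)

theorem antideriv_add (u v : Coeffs) : antideriv (u + v) = antideriv u + antideriv v := by
  ext k
  simp [antideriv, mul_add]

theorem antideriv_sub (u v : Coeffs) : antideriv (u - v) = antideriv u - antideriv v := by
  ext k
  simp [antideriv, mul_sub]

theorem antideriv_smul (c : ℝ) (u : Coeffs) : antideriv (c • u) = c • antideriv u := by
  ext k
  simp only [antideriv, Pi.smul_apply, mul_smul_comm]

end Antiderivative

section Multiplier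

variable {b c : ℤ → ℝ} {u v : Coeffs} {s C C' K M : ℝ}

theorem multiplier_one (u : Coeffs) : multiplier 1 u = u := by
  ext k
  simp [multiplier]

theorem multiplier_add (b : ℤ → ℝ) (u v : Coeffs) :
    multiplier b (u + v) = multiplier b u + multiplier b v := by
  ext k
  simp [multiplier, mul_add]

theorem multiplier_smul (b : ℤ → ℝ) (c : ℝ) (u : Coeffs) :
    multiplier b (c • u) = c • multiplier b u := by
  ext k
  simp only [multiplier, Pi.smul_apply, mul_smul_comm]

theorem sub_multiplier (b c : ℤ → ℝ) (u : Coeffs) :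
    multiplier (b - c) u = multiplier b u - multiplier c u := by
  ext k
  simp [multiplier, sub_mul]

theorem energy_term_antideriv_multiplier_le (hM0 : 0 ≤ M) (hbC : ∀ k, |b k| ≤ C)
    (hK : ∀ k : ℤ, b k ≠ 0 → K < |(k : ℝ)|)
    (hM : ∀ k : ℤ, b k ≠ 0 → (1 + (k : ℝ) ^ 2) ^ s * ‖u k‖ ^ 2 ≤ M) (k : ℤ) :
    (1 + (k : ℝ) ^ 2) ^ s * ‖antideriv (multiplier b u) k‖ ^ 2 ≤
      2 * C ^ 2 * M * if K < |(k : ℝ)| then (1 + (k : ℝ) ^ 2)⁻¹ else 0 := by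
  have hk1 := one_add_sq_pos k
  by_cases hbk : b k = 0
  · have hzero : antideriv (multiplier b u) k = 0 := by simp [antideriv, multiplier, hbk]
    rw [hzero, norm_zero, zero_pow two_ne_zero, mul_zero]
    exact mul_nonneg (by positivity) (tail_term_nonneg K k)
  have hsq : b k ^ 2 ≤ C ^ 2 := sq_le_sq' (neg_le_of_abs_le (hbC k)) (le_of_abs_le (hbC k))
  rw [if_pos (hK k hbk)]
  calc (1 + (k : ℝ) ^ 2) ^ s * ‖antideriv (multiplier b u) k‖ ^ 2
      ≤ 2 * ((1 + (k : ℝ) ^ 2) ^ (s - 1) * ‖multiplier b u k‖ ^ 2) := by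
        simpa using energy_term_antideriv_succ_le (s - 1) (multiplier b u) k
    _ = 2 * b k ^ 2 * ((1 + (k : ℝ) ^ 2) ^ s * ‖u k‖ ^ 2) * (1 + (k : ℝ) ^ 2)⁻¹ := by
        rw [Real.rpow_sub_one hk1.ne', multiplier, norm_mul, Complex.norm_real, mul_pow,
          Real.norm_eq_abs, sq_abs]
        ring
    _ ≤ 2 * C ^ 2 * M * (1 + (k : ℝ) ^ 2)⁻¹ := by
        gcongr
        exact hM k hbk

theorem finiteEnergy_antideriv_multiplier (hM0 : 0 ≤ M) (hbC : ∀ k, |b k| ≤ C)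
    (hM : ∀ k : ℤ, (1 + (k : ℝ) ^ 2) ^ s * ‖u k‖ ^ 2 ≤ M) :
    FiniteEnergy s (antideriv (multiplier b u)) :=
  .of_nonneg_of_le (energy_term_nonneg _ _)
    (energy_term_antideriv_multiplier_le hM0 hbC
      (fun _ _ => neg_one_lt_zero.trans_le (abs_nonneg _)) fun k _ => hM k)
    ((summable_tail (-1)).mul_left (2 * C ^ 2 * M))

theorem energy_antideriv_multiplier_le (hM0 : 0 ≤ M) (hbC : ∀ k, |b k| ≤ C)
    (hK : ∀ k : ℤ, b k ≠ 0 → K < |(k : ℝ)|)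
    (hM : ∀ k : ℤ, b k ≠ 0 → (1 + (k : ℝ) ^ 2) ^ s * ‖u k‖ ^ 2 ≤ M) :
    energy s (antideriv (multiplier b u)) ≤ 2 * C ^ 2 * M * tail K := by
  have hterm := energy_term_antideriv_multiplier_le hM0 hbC hK hM
  have hsum := (summable_tail K).mul_left (2 * C ^ 2 * M)
  rw [tail, ← tsum_mul_left]
  exact (Summable.of_nonneg_of_le (energy_term_nonneg _ _) hterm hsum).tsum_le_tsum hterm hsum

theorem IsRealValued.multiplier (hb : ∀ k, b (-k) = b k) (hu : IsRealValued u) :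
    IsRealValued (TorusSobolev.multiplier b u) := by
  intro k
  simp [TorusSobolev.multiplier, hb, hu k]

/-- Even symbols bounded by `C`: those of the real, translation-invariant operators that are
bounded by `C` and commute with reflections. -/
structure IsEvenBounded (C : ℝ) (b : ℤ → ℝ) : Prop where
  even : ∀ k, b (-k) = b k
  abs_le : ∀ k, |b k| ≤ C

theorem IsEvenBounded.nonneg (hb : IsEvenBounded C b) : 0 ≤ C := (abs_nonneg _).trans (hb.abs_le 0)

theorem IsEvenBounded.sub (hb : IsEvenBounded C b) (hc : IsEvenBounded C' c) :
    IsEvenBounded (C + C') (b - c) where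
  even k := by simp [hb.even, hc.even]
  abs_le k := (abs_sub _ _).trans (add_le_add (hb.abs_le k) (hc.abs_le k))

theorem isEvenBounded_one : IsEvenBounded 1 1 := ⟨fun _ => rfl, fun _ => by simp⟩

/-- The truncation of the symbol `b` to the frequencies `|k| ≤ K`. -/
noncomputable def lowPart (b : ℤ → ℝ) (K : ℝ) (k : ℤ) : ℝ := if |(k : ℝ)| ≤ K then b k else 0

theorem IsEvenBounded.lowPart (hb : IsEvenBounded C b) (K : ℝ) :
    IsEvenBounded C (lowPart b K) where
  even k := by simp [TorusSobolev.lowPart, hb.even]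
  abs_le k := by
    rw [TorusSobolev.lowPart]
    split_ifs
    · exact hb.abs_le k
    · simpa using hb.nonneg

theorem lowPart_eq {k : ℤ} (hk : |(k : ℝ)| ≤ K) : lowPart b K k = b k := if_pos hk

theorem abs_le_of_lowPart_ne_zero {k : ℤ} (h : lowPart b K k ≠ 0) : |(k : ℝ)| ≤ K := by
  by_contra hk
  exact h (if_neg hk)

theorem support_lowPart_finite (b : ℤ → ℝ) (K : ℝ) : (lowPart b K).support.Finite := by
  refine (Set.finite_Icc (-⌈K⌉) ⌈K⌉).subset fun k hk => ?_
  obtain ⟨hl, hu⟩ := abs_le.1 ((abs_le_of_lowPart_ne_zero hk).trans (Int.le_ceil K))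
  exact ⟨by exact_mod_cast hl, by exact_mod_cast hu⟩

end Multiplier

section ModelSpace

variable {s : ℝ} {u v : Coeffs}

/-- The real Banach space of square summable sequences `x` with `x(-k) = conj x(k)` and `x(0) = 0`.
It is a model of every `H^s_0`, with `x(k) = (1 + k²)^{s/2} û(k)`. -/
noncomputable def modelSpace : Submodule ℝ (lp (fun _ : ℤ => ℂ) 2) where
  carrier := {x | IsRealValued x ∧ x 0 = 0}
  add_mem' hx hy := ⟨fun k => by simp [hx.1 k, hy.1 k], by simp [hx.2, hy.2]⟩
  zero_mem' := ⟨fun k => by simp, by simp⟩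
  smul_mem' c x hx := ⟨fun k => by simp [hx.1 k], by simp [hx.2]⟩

theorem isClosed_modelSpace : IsClosed (modelSpace : Set (lp (fun _ : ℤ => ℂ) 2)) := by
  have happly (k : ℤ) : Continuous fun x : lp (fun _ : ℤ => ℂ) 2 => x k :=
    (continuous_apply k).comp lp.uniformContinuous_coe.continuous
  have hinter : (modelSpace : Set (lp (fun _ : ℤ => ℂ) 2)) =
      (⋂ k : ℤ, {x | x (-k) = conj (x k)}) ∩ {x | x 0 = 0} := by
    ext x
    simp only [Set.mem_inter_iff, Set.mem_iInter, Set.mem_ofPred_eq]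
    rfl
  rw [hinter]
  exact (isClosed_iInter fun k =>
    isClosed_eq (happly _) (Complex.continuous_conj.comp (happly k))).inter
    (isClosed_eq (happly 0) continuous_const)

noncomputable instance : CompleteSpace modelSpace := isClosed_modelSpace.completeSpace_coe

/-- The Fourier coefficients of the element of `H^s_0` represented by `x`. -/
noncomputable def coef (s : ℝ) (x : modelSpace) : Coeffs := fun k => (weight (-s) k : ℂ) * x.1 k

theorem summable_norm_sq (x : lp (fun _ : ℤ => ℂ) 2) : Summable fun k => ‖x k‖ ^ 2 := by
  simpa using (lp.memℓp x).summable (by norm_num)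

theorem norm_sq_eq_tsum (x : lp (fun _ : ℤ => ℂ) 2) : ‖x‖ ^ 2 = ∑' k, ‖x k‖ ^ 2 := by
  simpa using lp.norm_rpow_eq_tsum (p := 2) (by norm_num) x

theorem energy_term_coef (s : ℝ) (x : modelSpace) (k : ℤ) :
    (1 + (k : ℝ) ^ 2) ^ s * ‖coef s x k‖ ^ 2 = ‖x.1 k‖ ^ 2 := by
  rw [coef, norm_mul, Complex.norm_real, Real.norm_of_nonneg (weight_pos _ _).le, ← weight_sq,
    ← mul_pow, ← mul_assoc, weight_mul, add_neg_cancel, weight_zero, one_mul]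

theorem energy_coef (s : ℝ) (x : modelSpace) : energy s (coef s x) = ‖x‖ ^ 2 := by
  simp only [energy, energy_term_coef]
  exact (norm_sq_eq_tsum x.1).symm

theorem memHs0_coef (s : ℝ) (x : modelSpace) : MemHs0 s (coef s x) where
  summable := by simpa only [energy_term_coef] using summable_norm_sq x.1
  real_valued k := by simp [coef, weight_neg, x.2.1 k]
  mean_zero := by simp [coef, x.2.2]

theorem finiteEnergy_coef (s : ℝ) (x : modelSpace) : FiniteEnergy s (coef s x) :=
  (memHs0_coef s x).summable

theorem isRealValued_coef (s : ℝ) (x : modelSpace) : IsRealValued (coef s x) :=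
  (memHs0_coef s x).real_valued

theorem energy_zero_coef_le (hs : 0 ≤ s) (x : modelSpace) : energy 0 (coef s x) ≤ ‖x‖ ^ 2 :=
  (energy_mono hs (finiteEnergy_coef s x)).trans_eq (energy_coef s x)

theorem coef_add (s : ℝ) (x y : modelSpace) : coef s (x + y) = coef s x + coef s y := by
  ext k
  simp [coef, mul_add]

theorem coef_neg (s : ℝ) (x : modelSpace) : coef s (-x) = -coef s x := by
  ext k
  simp [coef]

theorem coef_sub (s : ℝ) (x y : modelSpace) : coef s (x - y) = coef s x - coef s y := by
  rw [sub_eq_add_neg, coef_add, coef_neg, sub_eq_add_neg]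

theorem coef_smul (s c : ℝ) (x : modelSpace) : coef s (c • x) = c • coef s x := by
  ext k
  simp only [coef, Submodule.coe_smul, lp.coeFn_smul, Pi.smul_apply, mul_smul_comm]

theorem coef_injective (s : ℝ) : Function.Injective (coef s) := by
  intro x y h
  ext k
  exact mul_left_cancel₀ (by exact_mod_cast (weight_pos (-s) k).ne') (congrFun h k)

theorem exists_coef_eq (hu : MemHs0 s u) : ∃ x, coef s x = u := by
  have hmem : Memℓp (fun k => (weight s k : ℂ) * u k) 2 :=
    (memℓp_gen_iff (by norm_num)).2 <| hu.summable.congr fun k => by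
      simp [abs_of_pos (weight_pos s k), mul_pow, weight_sq]
  have hreal : IsRealValued fun k => (weight s k : ℂ) * u k := fun k => by
    simp [weight_neg, hu.real_valued k]
  refine ⟨⟨⟨_, hmem⟩, hreal, by simp [hu.mean_zero]⟩, ?_⟩
  ext k
  change (weight (-s) k : ℂ) * ((weight s k : ℂ) * u k) = u k
  rw [← mul_assoc, ← Complex.ofReal_mul, weight_mul, neg_add_cancel, weight_zero,
    Complex.ofReal_one, one_mul]

theorem MemHs0.sub (hu : MemHs0 s u) (hv : MemHs0 s v) : MemHs0 s (u - v) := by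
  obtain ⟨x, rfl⟩ := exists_coef_eq hu
  obtain ⟨y, rfl⟩ := exists_coef_eq hv
  rw [← coef_sub]
  exact memHs0_coef s (x - y)

/-- The element of the model space that represents `u` in `H^s_0`; an arbitrary element if `u` does
not lie in `H^s_0`. -/
noncomputable def toModel (s : ℝ) : Coeffs → modelSpace := Function.invFun (coef s)

theorem coef_toModel (hu : MemHs0 s u) : coef s (toModel s u) = u :=
  Function.invFun_eq (exists_coef_eq hu)

theorem norm_toModel_sq (hu : MemHs0 s u) : ‖toModel s u‖ ^ 2 = energy s u := by
  rw [← energy_coef s, coef_toModel hu]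

/-- The representative in `L²` of the element of `H^s_0` represented by `x`, for `0 ≤ s`. -/
noncomputable def toL2 (s : ℝ) (x : modelSpace) : modelSpace := toModel 0 (coef s x)

theorem coef_toL2 (hs : 0 ≤ s) (x : modelSpace) : coef 0 (toL2 s x) = coef s x :=
  coef_toModel ⟨(finiteEnergy_coef s x).mono hs, isRealValued_coef s x, (memHs0_coef s x).mean_zero⟩

theorem norm_toL2_sq (hs : 0 ≤ s) (x : modelSpace) : ‖toL2 s x‖ ^ 2 = energy 0 (coef s x) := by
  rw [← energy_coef 0, coef_toL2 hs]

theorem norm_toL2_le (hs : 0 ≤ s) (x : modelSpace) : ‖toL2 s x‖ ≤ ‖x‖ :=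
  le_of_sq_le_sq ((norm_toL2_sq hs x).trans_le (energy_zero_coef_le hs x)) (norm_nonneg x)

theorem toL2_add (hs : 0 ≤ s) (x y : modelSpace) : toL2 s (x + y) = toL2 s x + toL2 s y :=
  coef_injective 0 (by simp only [coef_toL2 hs, coef_add])

theorem toL2_smul (hs : 0 ≤ s) (c : ℝ) (x : modelSpace) : toL2 s (c • x) = c • toL2 s x :=
  coef_injective 0 (by simp only [coef_toL2 hs, coef_smul])

end ModelSpace

section Bilinear

variable {s C C' K : ℝ} {b c : ℤ → ℝ}

theorem one_add_sq_rpow_mul_norm_mul_coef_sq_le (hs : 0 ≤ s) (x y : modelSpace) (k : ℤ) :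
    (1 + (k : ℝ) ^ 2) ^ s * ‖mul (coef s x) (coef s y) k‖ ^ 2 ≤
      2 * 4 ^ s * (‖x‖ ^ 2 * ‖toL2 s y‖ ^ 2 + ‖toL2 s x‖ ^ 2 * ‖y‖ ^ 2) := by
  rw [norm_toL2_sq hs, norm_toL2_sq hs, ← energy_coef s x, ← energy_coef s y]
  exact weight_mul_norm_mul_sq_le hs (finiteEnergy_coef s x) (finiteEnergy_coef s y) k

theorem memHs0_antideriv_multiplier_mul (hs : 0 ≤ s) (hb : IsEvenBounded C b) (x y : modelSpace) :
    MemHs0 s (antideriv (multiplier b (mul (coef s x) (coef s y)))) where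
  summable := finiteEnergy_antideriv_multiplier (by positivity) hb.abs_le
    (one_add_sq_rpow_mul_norm_mul_coef_sq_le hs x y)
  real_valued := IsRealValued.antideriv <|
    ((isRealValued_coef s x).mul (isRealValued_coef s y)).multiplier hb.even
  mean_zero := by simp [antideriv]

/-- The product `(v, w) ↦ ∂⁻¹ B(v w)` on `H^s_0`, where `B` has symbol `b`, in the model space. -/
noncomputable def antiderivMul (s : ℝ) (b : ℤ → ℝ) (x y : modelSpace) : modelSpace :=
  toModel s (antideriv (multiplier b (mul (coef s x) (coef s y))))

theorem coef_antiderivMul (hs : 0 ≤ s) (hb : IsEvenBounded C b) (x y : modelSpace) :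
    coef s (antiderivMul s b x y) = antideriv (multiplier b (mul (coef s x) (coef s y))) :=
  coef_toModel (memHs0_antideriv_multiplier_mul hs hb x y)

theorem antiderivMul_comm (s : ℝ) (b : ℤ → ℝ) (x y : modelSpace) :
    antiderivMul s b x y = antiderivMul s b y x := by
  rw [antiderivMul, antiderivMul, mul_comm_coeffs]

theorem antiderivMul_add (hs : 0 ≤ s) (hb : IsEvenBounded C b) (x y z : modelSpace) :
    antiderivMul s b x (y + z) = antiderivMul s b x y + antiderivMul s b x z := by
  have hfin := fun x => (finiteEnergy_coef s x).mono hs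
  apply coef_injective s
  simp only [coef_add, coef_antiderivMul hs hb, mul_add_coeffs (hfin x) (hfin y) (hfin z),
    multiplier_add, antideriv_add]

theorem antiderivMul_smul (hs : 0 ≤ s) (hb : IsEvenBounded C b) (t : ℝ) (x y : modelSpace) :
    antiderivMul s b x (t • y) = t • antiderivMul s b x y := by
  apply coef_injective s
  simp only [coef_smul, coef_antiderivMul hs hb, mul_smul_coeffs, multiplier_smul, antideriv_smul]

theorem sub_antiderivMul (hs : 0 ≤ s) (hb : IsEvenBounded C b) (hc : IsEvenBounded C' c)
    (x y : modelSpace) :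
    antiderivMul s (b - c) x y = antiderivMul s b x y - antiderivMul s c x y := by
  apply coef_injective s
  simp only [coef_sub, coef_antiderivMul hs hb, coef_antiderivMul hs hc,
    coef_antiderivMul hs (hb.sub hc), sub_multiplier, antideriv_sub]

theorem toL2_antiderivMul (hs : 0 ≤ s) (hb : IsEvenBounded C b) (x y : modelSpace) :
    toL2 s (antiderivMul s b x y) = antiderivMul 0 b (toL2 s x) (toL2 s y) := by
  apply coef_injective 0
  simp only [coef_toL2 hs, coef_antiderivMul hs hb, coef_antiderivMul le_rfl hb]

theorem norm_antiderivMul_le_of_high (hs : 0 ≤ s) (hb : IsEvenBounded C b)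
    (hK : ∀ k : ℤ, b k ≠ 0 → K < |(k : ℝ)|) (x y : modelSpace) :
    ‖antiderivMul s b x y‖ ≤
      C * √(4 * 4 ^ s * tail K) * (‖x‖ * ‖toL2 s y‖ + ‖toL2 s x‖ * ‖y‖) := by
  have hC := hb.nonneg
  have hK0 := tail_nonneg K
  refine le_of_sq_le_sq ?_ (by positivity)
  calc ‖antiderivMul s b x y‖ ^ 2
      = energy s (antideriv (multiplier b (mul (coef s x) (coef s y)))) :=
        norm_toModel_sq (memHs0_antideriv_multiplier_mul hs hb x y)
    _ ≤ 2 * C ^ 2 * (2 * 4 ^ s * (‖x‖ ^ 2 * ‖toL2 s y‖ ^ 2 + ‖toL2 s x‖ ^ 2 * ‖y‖ ^ 2)) * tail K :=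
        energy_antideriv_multiplier_le (by positivity) hb.abs_le hK
          fun k _ => one_add_sq_rpow_mul_norm_mul_coef_sq_le hs x y k
    _ = C ^ 2 * (4 * 4 ^ s * tail K) * ((‖x‖ * ‖toL2 s y‖) ^ 2 + (‖toL2 s x‖ * ‖y‖) ^ 2) := by ring
    _ ≤ C ^ 2 * (4 * 4 ^ s * tail K) * (‖x‖ * ‖toL2 s y‖ + ‖toL2 s x‖ * ‖y‖) ^ 2 := by
        gcongr
        exact pow_add_pow_le (by positivity) (by positivity) two_ne_zero
    _ = (C * √(4 * 4 ^ s * tail K) * (‖x‖ * ‖toL2 s y‖ + ‖toL2 s x‖ * ‖y‖)) ^ 2 := by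
        rw [mul_pow, mul_pow C, Real.sq_sqrt (by positivity)]

theorem norm_antiderivMul_le_of_low (hs : 0 ≤ s) (hb : IsEvenBounded C b)
    (hK : ∀ k : ℤ, b k ≠ 0 → |(k : ℝ)| ≤ K) (x y : modelSpace) :
    ‖antiderivMul s b x y‖ ≤
      C * √(2 * (1 + K ^ 2) ^ s * tail (-1)) * (‖toL2 s x‖ * ‖toL2 s y‖) := by
  have hC := hb.nonneg
  have htail := tail_nonneg (-1)
  refine le_of_sq_le_sq ?_ (by positivity)
  calc ‖antiderivMul s b x y‖ ^ 2
      = energy s (antideriv (multiplier b (mul (coef s x) (coef s y)))) :=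
        norm_toModel_sq (memHs0_antideriv_multiplier_mul hs hb x y)
    _ ≤ 2 * C ^ 2 * ((1 + K ^ 2) ^ s * (‖toL2 s x‖ ^ 2 * ‖toL2 s y‖ ^ 2)) * tail (-1) := by
        refine energy_antideriv_multiplier_le (by positivity) hb.abs_le
          (fun k _ => neg_one_lt_zero.trans_le (abs_nonneg _)) fun k hk => ?_
        rw [norm_toL2_sq hs, norm_toL2_sq hs]
        gcongr ?_ ^ s * ?_
        · exact add_le_add_right (sq_le_sq' (neg_le_of_abs_le (hK k hk)) (le_of_abs_le (hK k hk))) 1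
        · exact norm_mul_sq_le ((finiteEnergy_coef s x).mono hs) ((finiteEnergy_coef s y).mono hs) k
    _ = (C * √(2 * (1 + K ^ 2) ^ s * tail (-1)) * (‖toL2 s x‖ * ‖toL2 s y‖)) ^ 2 := by
        rw [mul_pow, mul_pow C, Real.sq_sqrt (by positivity)]
        ring

theorem norm_antiderivMul_le (hs : 0 ≤ s) (hb : IsEvenBounded C b)
    (hK : ∀ k : ℤ, b k ≠ 0 → K < |(k : ℝ)|) (x y : modelSpace) :
    ‖antiderivMul s b x y‖ ≤ 2 * (C * √(4 * 4 ^ s * tail K)) * ‖x‖ * ‖y‖ := by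
  have := hb.nonneg
  calc ‖antiderivMul s b x y‖
      ≤ C * √(4 * 4 ^ s * tail K) * (‖x‖ * ‖toL2 s y‖ + ‖toL2 s x‖ * ‖y‖) :=
        norm_antiderivMul_le_of_high hs hb hK x y
    _ ≤ C * √(4 * 4 ^ s * tail K) * (‖x‖ * ‖y‖ + ‖x‖ * ‖y‖) := by
        gcongr <;> exact norm_toL2_le hs _
    _ = 2 * (C * √(4 * 4 ^ s * tail K)) * ‖x‖ * ‖y‖ := by ring

/-- `antiderivMul` as a continuous bilinear map. -/
noncomputable def antiderivMulL (hs : 0 ≤ s) (hb : IsEvenBounded C b) :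
    modelSpace →L[ℝ] modelSpace →L[ℝ] modelSpace :=
  LinearMap.mkContinuous₂
    (LinearMap.mk₂ ℝ (antiderivMul s b)
      (fun x y z => by simp only [antiderivMul_comm s b _ z, antiderivMul_add hs hb])
      (fun t x y => by simp only [antiderivMul_comm s b _ y, antiderivMul_smul hs hb])
      (antiderivMul_add hs hb) (antiderivMul_smul hs hb))
    (2 * (C * √(4 * 4 ^ s * tail (-1))))
    (norm_antiderivMul_le hs hb fun _ _ => neg_one_lt_zero.trans_le (abs_nonneg _))

theorem antiderivMulL_apply (hs : 0 ≤ s) (hb : IsEvenBounded C b) (x y : modelSpace) :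
    antiderivMulL hs hb x y = antiderivMul s b x y := rfl

theorem tendsto_mul_sqrt_tail (C s : ℝ) :
    Filter.Tendsto (fun K => C * √(4 * 4 ^ s * tail K)) Filter.atTop (nhds 0) := by
  simpa using ((tendsto_tail.const_mul (4 * 4 ^ s)).sqrt).const_mul C

/- The splitting into low and high frequencies: the symbols supported in `|k| > K` have a small
operator, and those supported in `|k| ≤ K` only see the `L²` norms. -/
theorem exists_norm_antiderivMul_le (hs : 0 ≤ s) (C : ℝ) {ε : ℝ} (hε : 0 < ε) :
    ∃ A : ℝ, 0 ≤ A ∧ ∀ b, IsEvenBounded C b → ∀ x y : modelSpace,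
      ‖antiderivMul s b x y‖ ≤ A * (‖toL2 s x‖ * ‖toL2 s y‖) +
        ε * (‖x‖ * ‖toL2 s y‖ + ‖toL2 s x‖ * ‖y‖) := by
  obtain ⟨K, hK⟩ := ((tendsto_mul_sqrt_tail (C + C) s).eventually (ge_mem_nhds hε)).exists
  refine ⟨|C| * √(2 * (1 + K ^ 2) ^ s * tail (-1)), by positivity, fun b hb x y => ?_⟩
  have hlow := norm_antiderivMul_le_of_low hs (hb.lowPart K)
    (fun _ => abs_le_of_lowPart_ne_zero) x y
  have hhigh := norm_antiderivMul_le_of_high hs (hb.sub (hb.lowPart K)) (K := K) (fun k hk => by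
    by_contra h
    exact hk (by rw [Pi.sub_apply, lowPart_eq (not_lt.1 h), sub_self])) x y
  rw [sub_antiderivMul hs hb (hb.lowPart K)] at hhigh
  calc ‖antiderivMul s b x y‖
      ≤ ‖antiderivMul s (lowPart b K) x y‖ +
          ‖antiderivMul s b x y - antiderivMul s (lowPart b K) x y‖ :=
        norm_le_norm_add_norm_sub' _ _
    _ ≤ |C| * √(2 * (1 + K ^ 2) ^ s * tail (-1)) * (‖toL2 s x‖ * ‖toL2 s y‖) +
          ε * (‖x‖ * ‖toL2 s y‖ + ‖toL2 s x‖ * ‖y‖) := by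
        rw [abs_of_nonneg hb.nonneg]
        exact add_le_add hlow (hhigh.trans (by gcongr))

theorem exists_norm_antiderivMulL_sub_le (hs : 0 ≤ s) (C C' : ℝ) {ε : ℝ} (hε : 0 < ε) :
    ∃ N₀ : ℝ, ∀ N, N₀ ≤ N → ∀ (b c : ℤ → ℝ) (hb : IsEvenBounded C b) (hc : IsEvenBounded C' c),
      (∀ k : ℤ, |(k : ℝ)| ≤ N / 2 → b k = c k) →
      ∀ x : modelSpace, ‖antiderivMulL hs hb x - antiderivMulL hs hc x‖ ≤ ε * ‖x‖ := by
  obtain ⟨K, hK⟩ := Filter.eventually_atTop.1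
    ((tendsto_mul_sqrt_tail (C + C') s).eventually (ge_mem_nhds (half_pos hε)))
  refine ⟨2 * K, fun N hN b c hb hc hbc x =>
    ContinuousLinearMap.opNorm_le_bound _ (by positivity) fun y => ?_⟩
  calc ‖(antiderivMulL hs hb x - antiderivMulL hs hc x) y‖ = ‖antiderivMul s (b - c) x y‖ := by
        rw [sub_antiderivMul hs hb hc]
        rfl
    _ ≤ 2 * ((C + C') * √(4 * 4 ^ s * tail (N / 2))) * ‖x‖ * ‖y‖ :=
        norm_antiderivMul_le hs (hb.sub hc) (fun k hk => by
          by_contra h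
          exact hk (by rw [Pi.sub_apply, hbc k (not_lt.1 h), sub_self])) x y
    _ ≤ ε * ‖x‖ * ‖y‖ := by
        have := hK (N / 2) (by linarith)
        gcongr ?_ * _ * _
        linarith

end Bilinear

/-! ### Lower bounds for the linearization -/

section Truncation

/-- The projection of `x`, as an element of `L²`, to the frequencies `|k| ≤ n`. -/
noncomputable def truncate (n : ℕ) (x : modelSpace) : modelSpace :=
  toModel 0 (multiplier (lowPart 1 n) (coef 0 x))

theorem isRealTrigPoly_multiplier_lowPart_one (n : ℕ) (x : modelSpace) :
    IsRealTrigPoly (multiplier (lowPart 1 n) (coef 0 x)) where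
  finite_support := (support_lowPart_finite 1 n).subset fun k hk h => hk (by simp [multiplier, h])
  real_valued := (isRealValued_coef 0 x).multiplier (isEvenBounded_one.lowPart n).even

theorem coef_truncate (n : ℕ) (x : modelSpace) :
    coef 0 (truncate n x) = multiplier (lowPart 1 n) (coef 0 x) :=
  coef_toModel
    ⟨finiteEnergy_of_support_finite 0 (isRealTrigPoly_multiplier_lowPart_one n x).finite_support,
      (isRealTrigPoly_multiplier_lowPart_one n x).real_valued,
      by simp [multiplier, (memHs0_coef 0 x).mean_zero]⟩

theorem isRealTrigPoly_coef_truncate (n : ℕ) (x : modelSpace) :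
    IsRealTrigPoly (coef 0 (truncate n x)) :=
  coef_truncate n x ▸ isRealTrigPoly_multiplier_lowPart_one n x

theorem norm_sq_eq_tsum_coef (x : modelSpace) : ‖x‖ ^ 2 = ∑' k, ‖coef 0 x k‖ ^ 2 := by
  rw [← energy_coef 0, energy_zero]

theorem norm_truncate_le (n : ℕ) (x : modelSpace) : ‖truncate n x‖ ≤ ‖x‖ := by
  refine le_of_sq_le_sq ?_ (norm_nonneg x)
  rw [norm_sq_eq_tsum_coef, norm_sq_eq_tsum_coef]
  refine Summable.tsum_le_tsum (fun k => ?_) (finiteEnergy_zero_iff.1 (finiteEnergy_coef 0 _))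
    (finiteEnergy_zero_iff.1 (finiteEnergy_coef 0 _))
  rw [coef_truncate, multiplier, lowPart]
  split_ifs <;> simp

theorem tendsto_truncate (x : modelSpace) :
    Filter.Tendsto (fun n => truncate n x) Filter.atTop (nhds x) := by
  have hsq : Filter.Tendsto (fun n => ‖truncate n x - x‖ ^ 2) Filter.atTop (nhds 0) := by
    simp only [norm_sq_eq_tsum_coef, coef_sub, coef_truncate]
    rw [← tsum_zero (α := ℝ) (β := ℤ)]
    refine tendsto_tsum_of_dominated_convergence
      (finiteEnergy_zero_iff.1 (finiteEnergy_coef 0 x)) (fun k => ?_) (.of_forall fun n k => ?_)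
    · refine tendsto_const_nhds.congr' ?_
      filter_upwards [Filter.eventually_ge_atTop k.natAbs] with n hn
      have hk : |(k : ℝ)| ≤ n := by
        rw [← Int.cast_abs, Int.abs_eq_natAbs]
        exact_mod_cast hn
      simp [multiplier, lowPart_eq hk]
    · simp only [Pi.sub_apply, multiplier, lowPart]
      split_ifs <;> simp
  rw [tendsto_iff_norm_sub_tendsto_zero]
  simpa using hsq.sqrt

end Truncation

section LowerBounds

variable {s ρ : ℝ}

theorem exists_linearizationBddBelow_of_isRealTrigPoly (ρ : ℝ) : ∃ K : ℝ, 0 ≤ K ∧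
    ∀ a v : modelSpace, IsRealTrigPoly (coef 0 a) → IsRealTrigPoly (coef 0 v) → ‖a‖ ≤ ρ →
    ‖v‖ ≤ K * ‖v + (2 : ℝ) • antiderivMul 0 1 a v‖ := by
  obtain ⟨K, hK0, hK⟩ := exists_energy_zero_antideriv_mul_le (ρ ^ 2)
  refine ⟨1 + √K, by positivity, fun a v ha hv haρ => ?_⟩
  have hprod : antideriv (mul (coef 0 a) (coef 0 v)) = coef 0 (antiderivMul 0 1 a v) := by
    rw [coef_antiderivMul le_rfl isEvenBounded_one, multiplier_one]
  have henergy := hK _ _ ha hv (memHs0_coef 0 a).mean_zero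
    ((energy_coef 0 a).trans_le (pow_le_pow_left₀ (norm_nonneg a) haρ 2))
  rw [hprod, ← coef_smul, ← coef_smul, ← coef_add, energy_coef, energy_coef] at henergy
  have hsmall : ‖(-2 : ℝ) • antiderivMul 0 1 a v‖ ≤
      √K * ‖v + (2 : ℝ) • antiderivMul 0 1 a v‖ := by
    refine le_of_sq_le_sq ?_ (by positivity)
    rwa [mul_pow, Real.sq_sqrt hK0]
  calc ‖v‖ = ‖(v + (2 : ℝ) • antiderivMul 0 1 a v) + (-2 : ℝ) • antiderivMul 0 1 a v‖ := by
        congr 1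
        module
    _ ≤ (1 + √K) * ‖v + (2 : ℝ) • antiderivMul 0 1 a v‖ := by
        linarith [norm_add_le (v + (2 : ℝ) • antiderivMul 0 1 a v)
          ((-2 : ℝ) • antiderivMul 0 1 a v)]

theorem exists_linearizationBddBelow_zero (ρ : ℝ) : ∃ K : ℝ, 0 ≤ K ∧
    LinearizationBddBelow (antiderivMulL le_rfl isEvenBounded_one) ρ K := by
  obtain ⟨K, hK0, hK⟩ := exists_linearizationBddBelow_of_isRealTrigPoly ρ
  refine ⟨K, hK0, fun a ha v => ?_⟩
  have hcont : Continuous fun p : modelSpace × modelSpace =>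
      p.2 + (2 : ℝ) • antiderivMulL le_rfl isEvenBounded_one p.1 p.2 := by fun_prop
  exact le_of_tendsto_of_tendsto' (tendsto_truncate v).norm
    (((hcont.tendsto (a, v)).comp
      ((tendsto_truncate a).prodMk_nhds (tendsto_truncate v))).norm.const_mul K)
    fun n => hK _ _ (isRealTrigPoly_coef_truncate n a) (isRealTrigPoly_coef_truncate n v)
      ((norm_truncate_le n a).trans ha)

theorem exists_linearizationBddBelow_one (hs : 0 ≤ s) (hρ : 0 ≤ ρ) : ∃ K : ℝ, 0 < K ∧
    LinearizationBddBelow (antiderivMulL hs isEvenBounded_one) ρ K := by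
  obtain ⟨K, hK0, hK⟩ := exists_linearizationBddBelow_zero ρ
  set ε : ℝ := 1 / (4 * (ρ + 1)) with hε
  have hε0 : 0 < ε := by positivity
  have hερ : ε * ρ ≤ 1 / 4 := by
    rw [hε, one_div_mul_eq_div, div_le_div_iff₀ (by positivity) (by norm_num)]
    linarith
  obtain ⟨A, hA0, hA⟩ := exists_norm_antiderivMul_le hs 1 hε0
  refine ⟨2 * (1 + 2 * (A + ε) * ρ * K), by positivity, fun a ha v => ?_⟩
  rw [antiderivMulL_apply]
  set q := antiderivMul s 1 a v
  set z := v + (2 : ℝ) • q with hz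
  have ha2 : ‖toL2 s a‖ ≤ ρ := (norm_toL2_le hs a).trans ha
  have hv2 : ‖toL2 s v‖ ≤ K * ‖z‖ := by
    have h := hK (toL2 s a) ha2 (toL2 s v)
    rw [antiderivMulL_apply, ← toL2_antiderivMul hs isEvenBounded_one, ← toL2_smul hs,
      ← toL2_add hs] at h
    exact h.trans (mul_le_mul_of_nonneg_left (norm_toL2_le hs z) hK0)
  have hqle : ‖q‖ ≤ A * (ρ * (K * ‖z‖)) + ε * (ρ * (K * ‖z‖) + ρ * ‖v‖) :=
    (hA 1 isEvenBounded_one a v).trans (by gcongr)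
  have hv : ‖v‖ ≤ ‖z‖ + 2 * ‖q‖ := by
    calc ‖v‖ = ‖z - (2 : ℝ) • q‖ := by rw [hz, add_sub_cancel_right]
      _ ≤ ‖z‖ + 2 * ‖q‖ := (norm_sub_le _ _).trans_eq (by rw [norm_smul, Real.norm_ofNat])
  linarith [mul_le_mul_of_nonneg_right hερ (norm_nonneg v)]

/-- Even symbols bounded by `C` that equal `1` at the frequencies `|k| ≤ N / 2`: what the inversion
of the modified Miura map uses of a bump adapted to `[-N, N]`. -/
structure IsAdaptedSymbol (C N : ℝ) (b : ℤ → ℝ) : Prop extends IsEvenBounded C b where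
  eq_one : ∀ k : ℤ, |(k : ℝ)| ≤ N / 2 → b k = 1

theorem IsAdaptedBump.isAdaptedSymbol {C : ℕ → ℝ} {N : ℝ} {β : ℝ → ℝ} (hβ : IsAdaptedBump C N β) :
    IsAdaptedSymbol (C 0) N fun k => β k where
  even k := by simp [hβ.even]
  abs_le k := by simpa using hβ.bound 0 k
  eq_one k := hβ.eq_one k

theorem IsAdaptedSymbol.apply_zero {C N : ℝ} {b : ℤ → ℝ} (hb : IsAdaptedSymbol C N b)
    (hN : 0 ≤ N) : b 0 = 1 :=
  hb.eq_one 0 (by simpa using div_nonneg hN zero_le_two)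

theorem isAdaptedSymbol_one (N : ℝ) : IsAdaptedSymbol 1 N 1 where
  toIsEvenBounded := isEvenBounded_one
  eq_one _ _ := rfl

theorem IsAdaptedSymbol.lowPart {C N M : ℝ} {b : ℤ → ℝ} (hb : IsAdaptedSymbol C N b)
    (hNM : N ≤ M) : IsAdaptedSymbol C N (lowPart b (M / 2)) where
  toIsEvenBounded := hb.toIsEvenBounded.lowPart _
  eq_one k hk := (lowPart_eq (hk.trans (by linarith))).trans (hb.eq_one k hk)

theorem exists_linearizationBddBelow (hs : 0 ≤ s) (C : ℝ) (hρ : 0 ≤ ρ) :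
    ∃ K N₀ : ℝ, 0 < K ∧ ∀ N, N₀ ≤ N → ∀ (b : ℤ → ℝ) (hb : IsAdaptedSymbol C N b),
      LinearizationBddBelow (antiderivMulL hs hb.toIsEvenBounded) ρ K := by
  obtain ⟨K, hK0, hK⟩ := exists_linearizationBddBelow_one hs hρ
  obtain ⟨N₀, hN₀⟩ := exists_norm_antiderivMulL_sub_le hs 1 C (ε := 1 / (8 * K * (ρ + 1)))
    (by positivity)
  refine ⟨2 * K, N₀, by positivity, fun N hN b hb => hK.of_norm_sub_le hK0 fun a ha => ?_⟩
  calc _ ≤ 1 / (8 * K * (ρ + 1)) * ‖a‖ :=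
        hN₀ N hN 1 b _ _ (fun k hk => (hb.eq_one k hk).symm) a
    _ ≤ 1 / (8 * K * (ρ + 1)) * (ρ + 1) := by
        gcongr
        linarith
    _ = 1 / (8 * K) := by field_simp

end LowerBounds

/-! ### A priori bounds -/

section APriori

variable {s R r : ℝ}

theorem exists_norm_antiderivMul_self_sub_le_one (hs : 0 ≤ s) (C C' ρ : ℝ) : ∃ N₀ : ℝ,
    ∀ N, N₀ ≤ N → ∀ b c : ℤ → ℝ, IsEvenBounded C b → IsEvenBounded C' c →
      (∀ k : ℤ, |(k : ℝ)| ≤ N / 2 → b k = c k) → ∀ v : modelSpace, ‖v‖ ≤ ρ →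
      ‖antiderivMul s b v v - antiderivMul s c v v‖ ≤ 1 := by
  obtain ⟨N₀, hN₀⟩ := exists_norm_antiderivMulL_sub_le hs C C' (ε := 1 / (ρ ^ 2 + 1))
    (by positivity)
  refine ⟨N₀, fun N hN b c hb hc hbc v hv => ?_⟩
  calc ‖antiderivMul s b v v - antiderivMul s c v v‖
      ≤ ‖antiderivMulL hs hb v - antiderivMulL hs hc v‖ * ‖v‖ :=
        (antiderivMulL hs hb v - antiderivMulL hs hc v).le_opNorm v
    _ ≤ 1 / (ρ ^ 2 + 1) * ‖v‖ * ‖v‖ := by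
        gcongr
        exact hN₀ N hN b c hb hc hbc v
    _ = ‖v‖ ^ 2 / (ρ ^ 2 + 1) := by ring
    _ ≤ 1 := by
        rw [div_le_one (by positivity)]
        exact (pow_le_pow_left₀ (norm_nonneg v) hv 2).trans (by linarith)

/- The correction `w = v - y` to the datum `y = v + ∂⁻¹ B(v²)` solves `w = -∂⁻¹ B((w + y)²)`. -/
theorem exists_norm_toL2_le_of_support_finite (hs : 1 / 2 ≤ s) (C : ℝ) (hR : 0 ≤ R) :
    ∃ r N₀ : ℝ, 0 ≤ r ∧ ∀ N, N₀ ≤ N → ∀ b, IsAdaptedSymbol C N b → (∀ k, 0 ≤ b k) →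
      b.support.Finite → ∀ v, ‖v + antiderivMul s b v v‖ ≤ R → ‖toL2 s v‖ ≤ r := by
  have hs0 : 0 ≤ s := by linarith
  obtain ⟨N₀, Λ, -, hΛ⟩ := exists_energy_zero_le C (sq_nonneg R)
  refine ⟨√Λ + R, N₀, by positivity, fun N hN b hb hb0 hbfin v hv => ?_⟩
  set y := v + antiderivMul s b v v with hy
  set w := -antiderivMul s b v v with hw
  have hwy : w + y = v := by rw [hw, hy]; abel
  have hcoef : coef s w = -antideriv (multiplier b (mul (coef s w + coef s y)
      (coef s w + coef s y))) := by
    rw [← coef_add, hwy, hw, coef_neg, coef_antiderivMul hs0 hb.toIsEvenBounded]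
  have hpoly : IsRealTrigPoly (coef s w) := by
    refine ⟨hbfin.subset fun k hk h => hk ?_, isRealValued_coef s w⟩
    rw [hcoef]
    simp [antideriv, multiplier, h]
  have hyR : energy (1 / 2) (coef s y) ≤ R ^ 2 :=
    calc energy (1 / 2) (coef s y) ≤ energy s (coef s y) := energy_mono hs (finiteEnergy_coef s y)
      _ = ‖y‖ ^ 2 := energy_coef s y
      _ ≤ R ^ 2 := pow_le_pow_left₀ (norm_nonneg y) hv 2
  have hwΛ : ‖toL2 s w‖ ≤ √Λ := Real.le_sqrt_of_sq_le <| (norm_toL2_sq hs0 w).trans_le <|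
    hΛ N hN b hb0 (fun k => le_of_abs_le (hb.abs_le k)) hb.eq_one _ _ hpoly
      ((finiteEnergy_coef s y).mono hs) hyR hcoef
  calc ‖toL2 s v‖ = ‖toL2 s w + toL2 s y‖ := by rw [← toL2_add hs0, hwy]
    _ ≤ √Λ + R := (norm_add_le _ _).trans (add_le_add hwΛ ((norm_toL2_le hs0 y).trans hv))

theorem exists_norm_le_of_norm_toL2_le (hs : 0 ≤ s) (C R : ℝ) (hr : 0 ≤ r) :
    ∃ ρ : ℝ, ∀ b, IsEvenBounded C b → ∀ v, ‖toL2 s v‖ ≤ r →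
      ‖v + antiderivMul s b v v‖ ≤ R → ‖v‖ ≤ ρ := by
  set ε : ℝ := 1 / (4 * (r + 1)) with hε
  have hε0 : 0 < ε := by positivity
  have hεr : ε * r ≤ 1 / 4 := by
    rw [hε, one_div_mul_eq_div, div_le_div_iff₀ (by positivity) (by norm_num)]
    linarith
  obtain ⟨A, hA0, hA⟩ := exists_norm_antiderivMul_le hs C hε0
  refine ⟨2 * (R + A * (r * r)), fun b hb v hvr hvR => ?_⟩
  have hprod : ‖antiderivMul s b v v‖ ≤ A * (r * r) + ε * (‖v‖ * r + r * ‖v‖) :=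
    (hA b hb v v).trans (by gcongr)
  have hv : ‖v‖ ≤ ‖v + antiderivMul s b v v‖ + ‖antiderivMul s b v v‖ := by
    simpa using norm_sub_le (v + antiderivMul s b v v) (antiderivMul s b v v)
  linarith [mul_le_mul_of_nonneg_right hεr (norm_nonneg v)]

/- Truncating the symbol at a frequency that depends on `v` reduces to symbols of finite support. -/
theorem exists_norm_le_of_nonneg (hs : 1 / 2 ≤ s) (C : ℝ) (hR : 0 ≤ R) :
    ∃ ρ N₀ : ℝ, ∀ N, N₀ ≤ N → ∀ b, IsAdaptedSymbol C N b → (∀ k, 0 ≤ b k) →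
      ∀ v, ‖v + antiderivMul s b v v‖ ≤ R → ‖v‖ ≤ ρ := by
  have hs0 : 0 ≤ s := by linarith
  obtain ⟨r, N₀, hr0, hr⟩ := exists_norm_toL2_le_of_support_finite hs C (R := R + 1) (by linarith)
  obtain ⟨ρ, hρ⟩ := exists_norm_le_of_norm_toL2_le hs0 C (R + 1) hr0
  refine ⟨ρ, N₀, fun N hN b hb hb0 v hv => ?_⟩
  obtain ⟨M₀, hM₀⟩ := exists_norm_antiderivMul_self_sub_le_one hs0 C C ‖v‖
  set c := lowPart b (max N M₀ / 2)
  have hc : IsAdaptedSymbol C N c := hb.lowPart (le_max_left N M₀)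
  have hc0 (k : ℤ) : 0 ≤ c k := by
    simp only [c, lowPart]
    split_ifs
    · exact hb0 k
    · exact le_rfl
  have hvc : ‖v + antiderivMul s c v v‖ ≤ R + 1 :=
    calc ‖v + antiderivMul s c v v‖
        = ‖(v + antiderivMul s b v v) + (antiderivMul s c v v - antiderivMul s b v v)‖ := by
          congr 1
          abel
      _ ≤ R + 1 := (norm_add_le _ _).trans <| add_le_add hv <|
          hM₀ _ (le_max_right N M₀) c b hc.toIsEvenBounded hb.toIsEvenBounded
            (fun k hk => lowPart_eq hk) v le_rfl
  exact hρ c hc.toIsEvenBounded v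
    (hr N hN c hc hc0 (support_lowPart_finite b _) v hvc) hvc

/- Symbols of any sign are compared with the symbol `1`, whose solutions are bounded a priori. -/
theorem exists_norm_lt_of_norm_le (hs : 1 / 2 ≤ s) (C : ℝ) (hR : 0 ≤ R) :
    ∃ ρ₀ : ℝ, ∀ ρ, ρ₀ < ρ → ∃ N₀ : ℝ, ∀ N, N₀ ≤ N → ∀ b, IsAdaptedSymbol C N b →
      ∀ v, ‖v‖ ≤ ρ → ‖v + antiderivMul s b v v‖ ≤ R → ‖v‖ < ρ := by
  obtain ⟨ρ₀, N₁, hρ₀⟩ := exists_norm_le_of_nonneg hs 1 (R := R + 1) (by linarith)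
  refine ⟨ρ₀, fun ρ hρ => ?_⟩
  obtain ⟨N₂, hN₂⟩ := exists_norm_antiderivMul_self_sub_le_one (by linarith : 0 ≤ s) 1 C ρ
  refine ⟨max N₁ N₂, fun N hN b hb v hvρ hvR => ?_⟩
  have hdiff : ‖antiderivMul s 1 v v - antiderivMul s b v v‖ ≤ 1 :=
    hN₂ N (le_of_max_le_right hN) 1 b isEvenBounded_one hb.toIsEvenBounded
      (fun k hk => (hb.eq_one k hk).symm) v hvρ
  refine (hρ₀ N (le_of_max_le_left hN) 1 (isAdaptedSymbol_one N) (fun _ => zero_le_one) v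
    ?_).trans_lt hρ
  calc ‖v + antiderivMul s 1 v v‖
      = ‖(v + antiderivMul s b v v) + (antiderivMul s 1 v v - antiderivMul s b v v)‖ := by
        congr 1
        abel
    _ ≤ R + 1 := (norm_add_le _ _).trans (add_le_add hvR hdiff)

theorem exists_solution (hs : 1 / 2 ≤ s) (C : ℝ) (hR : 0 ≤ R) :
    ∃ ρ K N₀ : ℝ, 0 < K ∧ ∀ N, N₀ ≤ N → ∀ (b : ℤ → ℝ) (hb : IsAdaptedSymbol C N b),
      LinearizationBddBelow
        (antiderivMulL (one_half_pos.le.trans hs) hb.toIsEvenBounded) ρ K ∧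
      (∀ y : modelSpace, ‖y‖ ≤ R → ∃ v, ‖v‖ ≤ ρ ∧ v + antiderivMul s b v v = y) ∧
      ((∀ k, 0 ≤ b k) → ∀ v, ‖v + antiderivMul s b v v‖ ≤ R → ‖v‖ ≤ ρ) := by
  obtain ⟨ρ₁, N₁, hpos⟩ := exists_norm_le_of_nonneg hs C hR
  obtain ⟨ρ₂, hρ₂⟩ := exists_norm_lt_of_norm_le hs C hR
  obtain ⟨ρ, hρ⟩ := exists_gt (max 0 (max ρ₁ ρ₂))
  simp only [max_lt_iff] at hρ
  obtain ⟨hρ0, hρ₁ρ, hρ₂ρ⟩ := hρ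
  obtain ⟨N₂, hlt⟩ := hρ₂ ρ hρ₂ρ
  obtain ⟨K, N₃, hK0, hK⟩ := exists_linearizationBddBelow (one_half_pos.le.trans hs) C hρ0.le
  refine ⟨ρ, K, max N₁ (max N₂ N₃), hK0, fun N hN b hb => ?_⟩
  simp only [max_le_iff] at hN
  obtain ⟨hN₁, hN₂, hN₃⟩ := hN
  refine ⟨hK N hN₃ b hb, fun y hy => ?_, fun hb0 v hv => (hpos N hN₁ b hb hb0 v hv).trans hρ₁ρ.le⟩
  obtain ⟨v, hv, hvy⟩ :=
    (hK N hN₃ b hb).exists_eq (antiderivMul_comm s b) hρ0 (hlt N hN₂ b hb) hy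
  exact ⟨v, hv.le, hvy⟩

end APriori

/-! ### The modified Miura map in the model space -/

section ModifiedMiura

variable {s C : ℝ} {b : ℤ → ℝ} {u v : Coeffs}

theorem antideriv_modifiedMiura (b : ℤ → ℝ) (hv : v 0 = 0) :
    antideriv (modifiedMiura b v) = v + antideriv (multiplier b (mul v v)) := by
  ext k
  rcases eq_or_ne k 0 with rfl | hk
  · simp [antideriv, hv]
  · have : Complex.I * (k : ℂ) ≠ 0 := by simp [hk]
    simp only [antideriv, modifiedMiura, deriv, multiplier, mean, Pi.add_apply, Pi.sub_apply, hk,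
      if_false]
    field_simp
    ring

theorem modifiedMiura_zero (hb : b 0 = 1) (v : Coeffs) : modifiedMiura b v 0 = 0 := by
  simp [modifiedMiura, deriv, multiplier, mean, hb]

theorem modifiedMiura_coef_eq_iff (hs : 0 ≤ s + 1) (hb : IsEvenBounded C b) (hb0 : b 0 = 1)
    (hu : MemHs0 s u) (x : modelSpace) :
    modifiedMiura b (coef (s + 1) x) = u ↔
      x + antiderivMul (s + 1) b x x = toModel (s + 1) (antideriv u) := by
  rw [← (coef_injective (s + 1)).eq_iff, coef_toModel hu.antideriv, coef_add,
    coef_antiderivMul hs hb, ← antideriv_modifiedMiura b (memHs0_coef _ x).mean_zero]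
  exact (antideriv_injOn.eq_iff (modifiedMiura_zero hb0 _) hu.mean_zero).symm

theorem hsNorm_eq (s : ℝ) (u : Coeffs) : hsNorm s u = √(2 * Real.pi) * √(energy s u) := rfl

theorem hsNorm_coef (s : ℝ) (x : modelSpace) : hsNorm s (coef s x) = √(2 * Real.pi) * ‖x‖ := by
  rw [hsNorm_eq, energy_coef, Real.sqrt_sq (norm_nonneg x)]

theorem norm_le_hsNorm_coef (s : ℝ) (x : modelSpace) : ‖x‖ ≤ hsNorm s (coef s x) := by
  rw [hsNorm_coef]
  refine le_mul_of_one_le_left (norm_nonneg x) (Real.one_le_sqrt.2 ?_)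
  linarith [Real.pi_gt_three]

theorem norm_toModel_antideriv_le (hu : MemHs0 s u) :
    ‖toModel (s + 1) (antideriv u)‖ ≤ hsNorm s u := by
  rw [hsNorm_eq, ← Real.sqrt_mul (by positivity)]
  refine Real.le_sqrt_of_sq_le ?_
  calc ‖toModel (s + 1) (antideriv u)‖ ^ 2 = energy (s + 1) (antideriv u) :=
        norm_toModel_sq hu.antideriv
    _ ≤ 2 * energy s u := energy_antideriv_le hu
    _ ≤ 2 * Real.pi * energy s u := by
        have := energy_nonneg s u
        gcongr
        linarith [Real.pi_gt_three]

theorem toModel_antideriv_sub (hu : MemHs0 s u) (hv : MemHs0 s v) :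
    toModel (s + 1) (antideriv u) - toModel (s + 1) (antideriv v) =
      toModel (s + 1) (antideriv (u - v)) := by
  apply coef_injective (s + 1)
  rw [coef_sub, coef_toModel hu.antideriv, coef_toModel hv.antideriv,
    coef_toModel (hu.sub hv).antideriv, antideriv_sub]

theorem exists_modifiedMiura_coef_eq (hs : -1 / 2 ≤ s) (C : ℝ) {R : ℝ} (hR : 0 ≤ R) :
    ∃ ρ K N₀ : ℝ, 0 < K ∧ ∀ N, N₀ ≤ N → ∀ (b : ℤ → ℝ) (hb : IsAdaptedSymbol C N b), b 0 = 1 ∧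
      LinearizationBddBelow
        (antiderivMulL (by linarith : 0 ≤ s + 1) hb.toIsEvenBounded) ρ K ∧
      (∀ u ∈ ball s R, ∃ x, ‖x‖ ≤ ρ ∧ modifiedMiura b (coef (s + 1) x) = u) ∧
      ((∀ k, 0 ≤ b k) → ∀ x, modifiedMiura b (coef (s + 1) x) ∈ ball s R → ‖x‖ ≤ ρ) := by
  have hs1 : 0 ≤ s + 1 := by linarith
  obtain ⟨ρ, K, N₀, hK0, hsol⟩ := exists_solution (by linarith : 1 / 2 ≤ s + 1) C hR
  refine ⟨ρ, K, max 0 N₀, hK0, fun N hN b hb => ?_⟩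
  have hb0 : b 0 = 1 := hb.apply_zero (le_of_max_le_left hN)
  obtain ⟨hK, hex, hpos⟩ := hsol N (le_of_max_le_right hN) b hb
  have hball {u : Coeffs} (hu : u ∈ ball s R) : ‖toModel (s + 1) (antideriv u)‖ ≤ R :=
    (norm_toModel_antideriv_le hu.1).trans hu.2
  refine ⟨hb0, hK, fun u hu => ?_, fun hbpos x hx => hpos hbpos x ?_⟩
  · obtain ⟨x, hxρ, hx⟩ := hex _ (hball hu)
    exact ⟨x, hxρ, (modifiedMiura_coef_eq_iff hs1 hb.toIsEvenBounded hb0 hu.1 x).2 hx⟩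
  · rw [(modifiedMiura_coef_eq_iff hs1 hb.toIsEvenBounded hb0 hx.1 x).1 rfl]
    exact hball hx

variable {ρ K : ℝ} {x y : modelSpace} (hs : 0 ≤ s + 1) (hb : IsEvenBounded C b) (hb0 : b 0 = 1)
  (hK : LinearizationBddBelow (antiderivMulL hs hb) ρ K) (hx : ‖x‖ ≤ ρ) (hy : ‖y‖ ≤ ρ)
include hs hb hb0 hK hx hy

theorem eq_of_modifiedMiura_coef_eq (hu : MemHs0 s u) (hxu : modifiedMiura b (coef (s + 1) x) = u)
    (hyu : modifiedMiura b (coef (s + 1) y) = u) : x = y := by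
  rw [modifiedMiura_coef_eq_iff hs hb hb0 hu] at hxu hyu
  exact hK.injOn (antiderivMul_comm (s + 1) b) (mem_closedBall_zero_iff.2 hx)
    (mem_closedBall_zero_iff.2 hy) (hxu.trans hyu.symm)

theorem hsNorm_coef_sub_le (hK0 : 0 ≤ K) (hu : MemHs0 s u) (hv : MemHs0 s v)
    (hxu : modifiedMiura b (coef (s + 1) x) = u) (hyv : modifiedMiura b (coef (s + 1) y) = v) :
    hsNorm (s + 1) (coef (s + 1) x - coef (s + 1) y) ≤ √(2 * Real.pi) * K * hsNorm s (u - v) := by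
  rw [modifiedMiura_coef_eq_iff hs hb hb0 hu] at hxu
  rw [modifiedMiura_coef_eq_iff hs hb hb0 hv] at hyv
  have hxy := hK.norm_sub_le (antiderivMul_comm (s + 1) b) hx hy
  simp only [antiderivMulL_apply, hxu, hyv, toModel_antideriv_sub hu hv] at hxy
  rw [← coef_sub, hsNorm_coef, mul_assoc]
  gcongr
  refine hxy.trans ?_
  gcongr
  exact norm_toModel_antideriv_le (hu.sub hv)

end ModifiedMiura

end TorusSobolev

open TorusSobolev in
theorem mainTheorem8_general (s R C : ℝ) (hs : -1 / 2 ≤ s) (hR : 0 ≤ R) :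
    ∃ (N₀ L : ℝ) (N₁ : ℝ → ℝ), ∀ N : ℝ, N₀ ≤ N → ∀ b : ℤ → ℝ, IsAdaptedSymbol C N b →
      ∃ Minv : Coeffs → Coeffs,
        (∀ u ∈ ball s R, MemHs0 (s + 1) (Minv u) ∧ modifiedMiura b (Minv u) = u) ∧
        (∀ v, MemHs0 (s + 1) v → modifiedMiura b v ∈ ball s R →
          ((∀ k, 0 ≤ b k) ∨ ∃ ρ, hsNorm (s + 1) v ≤ ρ ∧ N₁ ρ ≤ N) →
          Minv (modifiedMiura b v) = v) ∧
        (∀ u₁ ∈ ball s R, ∀ u₂ ∈ ball s R,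
          hsNorm (s + 1) (Minv u₁ - Minv u₂) ≤ L * hsNorm s (u₁ - u₂)) := by
  have hs1 : 0 ≤ s + 1 := by linarith
  obtain ⟨ρ, K, N₀, hK0, hsol⟩ := exists_modifiedMiura_coef_eq hs C hR
  choose K' N₁ _ hK' using fun r : ℝ =>
    exists_linearizationBddBelow hs1 C ((abs_nonneg r).trans (le_max_right ρ |r|))
  refine ⟨N₀, √(2 * Real.pi) * K, N₁, fun N hN b hb => ?_⟩
  obtain ⟨hb0, hK, hex, hpos⟩ := hsol N hN b hb
  choose! inv hinvρ hinv using hex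
  refine ⟨fun u => coef (s + 1) (inv u), fun u hu => ⟨memHs0_coef _ _, hinv u hu⟩,
    fun v hv hu hcase => ?_, fun u₁ hu₁ u₂ hu₂ =>
      hsNorm_coef_sub_le hs1 hb.toIsEvenBounded hb0 hK (hinvρ _ hu₁) (hinvρ _ hu₂) hK0.le
        hu₁.1 hu₂.1 (hinv _ hu₁) (hinv _ hu₂)⟩
  obtain ⟨x, rfl⟩ := exists_coef_eq hv
  refine congrArg (coef (s + 1)) ?_
  rcases hcase with hbpos | ⟨r, hr, hrN⟩
  · exact eq_of_modifiedMiura_coef_eq hs1 hb.toIsEvenBounded hb0 hK (hinvρ _ hu)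
      (hpos hbpos x hu) hu.1 (hinv _ hu) rfl
  · have hxr : ‖x‖ ≤ |r| := ((norm_le_hsNorm_coef _ x).trans hr).trans (le_abs_self r)
    exact eq_of_modifiedMiura_coef_eq hs1 hb.toIsEvenBounded hb0 (hK' r N hrN b hb)
      ((hinvρ _ hu).trans (le_max_left _ _)) (hxr.trans (le_max_right _ _)) hu.1 (hinv _ hu) rfl

theorem mainTheorem8 (s R : ℝ) (hs : -1 / 2 ≤ s) (hR : 0 < R) (C : ℕ → ℝ) :
    ∃ (N₀ L : ℝ) (N₁ : ℝ → ℝ), ∀ N : ℝ, N₀ ≤ N →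
      ∀ β : ℝ → ℝ, TorusSobolev.IsAdaptedBump C N β →
        ∃ Minv : TorusSobolev.Coeffs → TorusSobolev.Coeffs,
          (∀ u ∈ TorusSobolev.ball s R, TorusSobolev.MemHs0 (s + 1) (Minv u) ∧
            TorusSobolev.modifiedMiura (fun k => β k) (Minv u) = u) ∧
          (∀ v, TorusSobolev.MemHs0 (s + 1) v →
            TorusSobolev.modifiedMiura (fun k => β k) v ∈ TorusSobolev.ball s R →
            ((∀ ξ, 0 ≤ β ξ) ∨ ∃ ρ, TorusSobolev.hsNorm (s + 1) v ≤ ρ ∧ N₁ ρ ≤ N) →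
            Minv (TorusSobolev.modifiedMiura (fun k => β k) v) = v) ∧
          (∀ u₁ ∈ TorusSobolev.ball s R, ∀ u₂ ∈ TorusSobolev.ball s R,
            TorusSobolev.hsNorm (s + 1) (Minv u₁ - Minv u₂) ≤
              L * TorusSobolev.hsNorm s (u₁ - u₂)) := by
  obtain ⟨N₀, L, N₁, h⟩ := mainTheorem8_general s R (C 0) hs hR.le
  refine ⟨N₀, L, N₁, fun N hN β hβ => ?_⟩
  obtain ⟨Minv, hright, hleft, hlip⟩ := h N hN _ hβ.isAdaptedSymbol
  exact ⟨Minv, hright, fun v hv hu hcase => hleft v hv hu (hcase.imp_left fun h k => h k), hlip⟩
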